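/- **Problem.** Let $I\in\mathbb N$, and for $i=1,\dots,I$ let $\mathcal X_i\subseteq\mathcal U_i\subseteq\mathbb R^{n_i}$, $\mathcal Y\subseteq\mathcal V\subseteq\mathbb R^{n_0}$, where $\mathcal X_i,\mathcal Y$ are nonempty, closed and convex and $\mathcal U_i,\mathcal V$ are open. Consider $$\mathcal P^{spd}:\ \min_{\mathbf x,\mathbf y}\ f(\mathbf x,\mathbf y)=f_0(\mathbf y)+\sum_{i} f_i(\mathbf x_i,\mathbf y)\quad\text{s.t.}\quad \tilde{\mathbf g}_i(\mathbf x_i,\mathbf y)\preceq 0,\ \mathbf A_{i,\mathbf x}\mathbf x_i+\mathbf A_{i,\mathbf y}\mathbf y+\mathbf b_i=0,\ \mathbf g_i(\mathbf x_i)\preceq0,\ \mathbf x_i\in\mathcal X_i\ \ (1\le i\le I),\quad \mathbf g_0(\mathbf y)\preceq 0,\ \mathbf y\in\mathcal Y,$$ where $f_i,\tilde{\mathbf g}_i$ are $C^1$ on $\mathcal U_i\times\mathcal V$, $\mathbf g_i$ on $\mathcal U_i$, and $f_0,\mathbf g_0$ on $\mathcal V$; $\nabla f_i$ is Lipschitz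 on $\mathcal X_i\times\mathcal Y$, $\nabla f_0$ is Lipschitz on $\mathcal Y$, and $f$ is bounded below on the feasible set. For a problem $\min f(\mathbf x)$ s.t. $\mathbf g(\mathbf x)\preceq0$, $\mathbf h(\mathbf x)=0$, $\mathbf x\in\mathcal X$: a feasible $\mathbf x$ is *stationary*, with Lagrange multipliers $\boldsymbol\mu\succeq0,\boldsymbol\lambda$, if $\mu_jg_j(\mathbf x)=0$ for all $j$ and $(\nabla f(\mathbf x)+\nabla\mathbf g(\mathbf x)\boldsymbol\mu+\nabla\mathbf h(\mathbf x)\boldsymbol\lambda)^T(\mathbf x'-\mathbf x)\ge0$ for all $\mathbf x'\in\mathcal X$; it is *regular* if $\boldsymbol\mu\succeq 0$, $\mu_j=0$ whenever $g_j(\mathbf x)\neq0$, and $(\nabla\mathbf g(\mathbf x)\boldsymbol\mu+\nabla\mathbf h(\mathbf x)\boldsymbol\lambda)^T(\mathbf x'-\mathbf x)\ge0$ for all $\mathbf x'\in\mathcal X$ imply $\boldsymbol\mu=0,\boldsymbol\lambda=0$. **Approximate functions.** Let $F_i,\widetilde{\mathbf G}_i$ ($i\ge1$) approximate $f_i,\tilde{\mathbf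 g}_i$ on $\mathcal X_i\times\mathcal Y$, let $\mathbf G_i$ approximate $\mathbf g_i$ on $\mathcal X_i$, and let $F_0,\mathbf G_0$ approximate $f_0,\mathbf g_0$ on $\mathcal Y$, in the following sense. Write $\mathcal X\subseteq\mathcal U$ for the respective closed convex set and the open set around it. * For an objective: $F(\cdot;\mathbf z)$ is $C^1$ on $\mathcal U$ for each $\mathbf z\in\mathcal X$ and strongly convex on $\mathcal X$ with a constant independent of $\mathbf z$; $\nabla F(\mathbf z;\mathbf z)=\nabla f(\mathbf z)$ for $\mathbf z\in\mathcal X$; and $\nabla F(\cdot;\cdot)$ (gradient in the first argument) is continuous on $\mathcal U\times\mathcal X$. * For a constraint: $\mathbf G(\cdot;\mathbf z)$ is componentwise convex on $\mathcal X$ and differentiable at the points of $\mathcal X$; $\mathbf G(\mathbf z;\mathbf z)=\mathbf g(\mathbf z)$, $\nabla\mathbf G(\mathbf z;\mathbf z)=\nabla\mathbf g(\mathbf z)$ and $\mathbf G(\mathbf x;\mathbf z)\succeq\mathbf g(\mathbf x)$ for $\mathbf x,\mathbf z\in\mathcal X$; and $\mathbf G$ and $\nabla\mathbf G$ are continuous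 on $\mathcal X\times\mathcal X$. Separability: for $i\ge1$, $F_i(\mathbf x_i,\mathbf y;\cdot)=F_{i,\mathbf x}(\mathbf x_i;\cdot)+F_{i,\mathbf y}(\mathbf y;\cdot)$ with $F_{i,\mathbf x},F_{i,\mathbf y}$ of class $C^1$ in the first argument, and $\widetilde{\mathbf G}_i(\mathbf x_i,\mathbf y;\cdot)=\widetilde{\mathbf G}_{i,\mathbf x}(\mathbf x_i;\cdot)+\mathbf C_i(\cdot)\mathbf y$ with $\widetilde{\mathbf G}_{i,\mathbf x},\mathbf C_i$ continuous. Given $(\mathbf x^{(k)},\mathbf y^{(k)})$, let $\mathcal P^{spd,(k)}$ be the convex problem in which the objective and inequality constraint functions of $\mathcal P^{spd}$ are replaced by their approximations at $(\mathbf x^{(k)},\mathbf y^{(k)})$. For fixed $\mathbf y$ let $\mathcal P^{spd,(k)}_{sub,i}$ be the problem of minimizing $F_i(\mathbf x_i,\mathbf y;\mathbf x_i^{(k)},\mathbf y^{(k)})$ over $\mathbf x_i\in\mathcal X_i$ subject to $\widetilde{\mathbf G}_i(\mathbf x_i,\mathbf y;\mathbf x_i^{(k)},\mathbf y^{(k)})\preceq0$,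 $\mathbf A_{i,\mathbf x}\mathbf x_i+\mathbf A_{i,\mathbf y}\mathbf y+\mathbf b_i=0$, $\mathbf G_i(\mathbf x_i;\mathbf x_i^{(k)})\preceq0$, and let $\mathcal C^{(k)}=\{\mathbf y\in\mathcal Y:\mathbf G_0(\mathbf y;\mathbf y^{(k)})\preceq0\}$. **SPD-A.** Start at a feasible point $(\mathbf x^{(0)},\mathbf y^{(0)})$ of $\mathcal P^{spd}$ and choose $\gamma^{(k)}\in(0,1]$ with $\gamma^{(k)}\to0$, $\sum_k\gamma^{(k)}=\infty$. For each $k$, run the inner loop: start at $\mathbf y^{(k,0)}=\mathbf y^{(k)}$ and choose $\gamma_{in}^{(k,t)}>0$ with $\sum_t\gamma_{in}^{(k,t)}=\infty$, $\sum_t(\gamma_{in}^{(k,t)})^2<\infty$; for $t=0,1,\dots$ take, for each $i$, the optimal point $\mathbf x_i^{(k,t)}$ of $\mathcal P^{spd,(k)}_{sub,i}$ for $\mathbf y=\mathbf y^{(k,t)}$, with Lagrange multipliers $\tilde{\boldsymbol\mu}_i^{(k,t)}$ and $\tilde{\boldsymbol\lambda}_i^{(k,t)}$ of the coupling inequality and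 the equality constraints, and set $$\mathbf s^{(k,t)}=\nabla_{\mathbf y}F_0(\mathbf y^{(k,t)};\mathbf y^{(k)})+\sum_i\Big(\nabla_{\mathbf y} F_{i,\mathbf y}(\mathbf y^{(k,t)};\mathbf x_i^{(k)},\mathbf y^{(k)})+\mathbf C_i(\mathbf x_i^{(k)},\mathbf y^{(k)})^T\tilde{\boldsymbol\mu}_i^{(k,t)}+\mathbf A_{i,\mathbf y}^T\tilde{\boldsymbol\lambda}_i^{(k,t)}\Big),$$ $$\mathbf y^{(k,t+1)}=\mathrm P_{\mathcal C^{(k)}}\big(\mathbf y^{(k,t)}-\gamma_{in}^{(k,t)}\mathbf s^{(k,t)}\big),$$ with $\mathrm P$ the Euclidean projection. With $(\hat{\mathbf x}^{(k)},\hat{\mathbf y}^{(k)})$ the limit of $(\mathbf x^{(k,t)},\mathbf y^{(k,t)})$ as $t\to\infty$ (its existence is part of the result), set $$(\mathbf x^{(k+1)},\mathbf y^{(k+1)})=(\mathbf x^{(k)},\mathbf y^{(k)})+\gamma^{(k)}\big((\hat{\mathbf x}^{(k)},\hat{\mathbf y}^{(k)})-(\mathbf x^{(k)},\mathbf y^{(k)})\big).$$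 **Statement.** Suppose that every feasible point of $\mathcal P^{spd}$ is regular, and that for all $k$, $i$ and every $\mathbf y\in\mathcal C^{(k)}$ for which all subproblems are feasible, every feasible point of $\mathcal P^{spd,(k)}_{sub,i}$ is regular and $\mathcal P^{spd,(k)}_{sub,i}$ satisfies Slater's condition (a point of the relative interior of $\mathcal X_i$ satisfies the equality constraints and, strictly, the inequality constraints). Suppose also that for each $k$ the inner iterates $(\mathbf x^{(k,t)},\mathbf y^{(k,t)})_{t}$ are bounded. Then for each $k$ the inner iterates converge to the unique optimal point of $\mathcal P^{spd,(k)}$; and if the sequence $\{(\mathbf x^{(k)},\mathbf y^{(k)})\}_{k}$ generated by SPD-A has a limit point, then at least one of its limit points is a stationary point of $\mathcal P^{spd}$. -/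

import Mathlib

open Set Filter Topology
open scoped Matrix

noncomputable section

/-- The Euclidean space of dimension `n`. -/
abbrev Vec (n : ℕ) : Type := EuclideanSpace ℝ (Fin n)

/-- Minimise `obj x` subject to `ineq j x ≤ 0`, `eqc l x = 0` and `x ∈ dom`. -/
structure NLP (E J M : Type) where
  obj : E → ℝ
  ineq : J → E → ℝ
  eqc : M → E → ℝ
  dom : Set E

namespace NLP

def feasibleSet {E J M : Type} (P : NLP E J M) : Set E :=
  {x | x ∈ P.dom ∧ (∀ j, P.ineq j x ≤ 0) ∧ ∀ l, P.eqc l x = 0}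

/-- Global optimality. -/
def IsOptimal {E J M : Type} (P : NLP E J M) (x : E) : Prop :=
  x ∈ P.feasibleSet ∧ ∀ v ∈ P.feasibleSet, P.obj x ≤ P.obj v

def IsUniqueOptimal {E J M : Type} (P : NLP E J M) (x : E) : Prop :=
  P.IsOptimal x ∧ ∀ v, P.IsOptimal v → v = x

section

variable {E J M : Type} [NormedAddCommGroup E] [NormedSpace ℝ E]

/-- The KKT conditions at `x` with Lagrange multipliers `mu` (inequalities) and `lam`
(equalities); gradients are written as Fréchet derivatives. -/
def IsKKT [Fintype J] [Fintype M] (P : NLP E J M) (x : E) (mu : J → ℝ) (lam : M → ℝ) : Prop :=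
  (∀ v ∈ P.dom, 0 ≤ (fderiv ℝ P.obj x + ∑ j, mu j • fderiv ℝ (P.ineq j) x
      + ∑ l, lam l • fderiv ℝ (P.eqc l) x) (v - x)) ∧
  (∀ j, mu j * P.ineq j x = 0) ∧ (∀ j, 0 ≤ mu j) ∧ x ∈ P.feasibleSet

/-- Stationary points: KKT points for some multipliers. -/
def IsStationary [Fintype J] [Fintype M] (P : NLP E J M) (x : E) : Prop :=
  ∃ (mu : J → ℝ) (lam : M → ℝ), P.IsKKT x mu lam

/-- The Mangasarian-Fromovitz constraint qualification at `x`, relative to the set `dom`,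
in its dual form. -/
def MFCQ [Fintype J] [Fintype M] (P : NLP E J M) (x : E) : Prop :=
  ∀ (mu : J → ℝ) (lam : M → ℝ),
    (∀ v ∈ P.dom, 0 ≤ (∑ j, mu j • fderiv ℝ (P.ineq j) x
      + ∑ l, lam l • fderiv ℝ (P.eqc l) x) (v - x)) →
    (∀ j, 0 ≤ mu j) → (∀ j, P.ineq j x ≠ 0 → mu j = 0) →
    mu = 0 ∧ lam = 0

/-- All feasible points are regular. -/
def AllRegular [Fintype J] [Fintype M] (P : NLP E J M) : Prop :=
  ∀ x ∈ P.feasibleSet, P.MFCQ x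

/-- Slater's condition: a point of the relative interior of `dom` that satisfies the
(affine) equality constraints and, strictly, the inequality constraints. -/
def Slater (P : NLP E J M) : Prop :=
  ∃ x ∈ intrinsicInterior ℝ P.dom, (∀ j, P.ineq j x < 0) ∧ ∀ l, P.eqc l x = 0

end

end NLP

section

variable {E : Type} [NormedAddCommGroup E] [NormedSpace ℝ E]

/-- `F (· ; z)`, written `F · z`, is a strongly convex approximation at `z` of the objective
`f` on the set `X`, where `X` is contained in the open set `U`. The constant `c` is
existentially quantified, so the choice among equivalent norms is immaterial. -/
structure IsObjectiveSurrogate (U X : Set E) (f : E → ℝ) (F : E → E → ℝ) : Prop where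
  contDiff : ∀ z ∈ X, ContDiffOn ℝ 1 (fun x => F x z) U
  strong : ∃ c : ℝ, 0 < c ∧ ∀ x ∈ X, ∀ v ∈ X, ∀ z ∈ X,
    c * ‖x - v‖ ^ 2 ≤
      (fderiv ℝ (fun u => F u z) x - fderiv ℝ (fun u => F u z) v) (x - v)
  grad_eq : ∀ z ∈ X, fderiv ℝ (fun x => F x z) z = fderiv ℝ f z
  grad_cont : ContinuousOn (fun p : E × E => fderiv ℝ (fun x => F x p.2) p.1) (U ×ˢ X)

/-- `G (· ; z)`, written `G · z`, is a convex upper approximation at `z` of the constraint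
function `g` on the set `X`. -/
structure IsConstraintSurrogate {r : ℕ} (X : Set E) (g : E → Fin r → ℝ)
    (G : E → E → Fin r → ℝ) : Prop where
  convex : ∀ z ∈ X, ∀ j, ConvexOn ℝ X (fun x => G x z j)
  val_eq : ∀ z ∈ X, G z z = g z
  upper : ∀ x ∈ X, ∀ z ∈ X, ∀ j, g x j ≤ G x z j
  cont : ContinuousOn (fun p : E × E => G p.1 p.2) (X ×ˢ X)
  diff : ∀ x ∈ X, ∀ z ∈ X, DifferentiableAt ℝ (fun u => G u z) x
  grad_eq : ∀ z ∈ X, fderiv ℝ (fun x => G x z) z = fderiv ℝ g z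
  grad_cont : ContinuousOn (fun p : E × E => fderiv ℝ (fun x => G x p.2) p.1) (X ×ˢ X)

end

/-- The data of the problem: minimise `f₀ y + ∑ i, f i (x i, y)` subject to
`gt i (x i, y) ≤ 0`, `Ax i x i + Ay i y + b i = 0`, `g i (x i) ≤ 0`, `x i ∈ X i`,
`g₀ y ≤ 0`, `y ∈ Y`. The functions matter only on the open sets `U i ⊇ X i`, `V ⊇ Y`. -/
structure SPDProblem where
  I : ℕ
  n : Fin I → ℕ
  n₀ : ℕ
  rt : Fin I → ℕ
  r : Fin I → ℕ
  r₀ : ℕ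
  m : Fin I → ℕ
  U : ∀ i, Set (Vec (n i))
  X : ∀ i, Set (Vec (n i))
  V : Set (Vec n₀)
  Y : Set (Vec n₀)
  f : ∀ i, Vec (n i) × Vec n₀ → ℝ
  f₀ : Vec n₀ → ℝ
  gt : ∀ i, Vec (n i) × Vec n₀ → Fin (rt i) → ℝ
  g : ∀ i, Vec (n i) → Fin (r i) → ℝ
  g₀ : Vec n₀ → Fin r₀ → ℝ
  Ax : ∀ i, Matrix (Fin (m i)) (Fin (n i)) ℝ
  Ay : ∀ i, Matrix (Fin (m i)) (Fin n₀) ℝ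
  b : ∀ i, Fin (m i) → ℝ

namespace SPDProblem

/-- The joint variable `(x, y)`, with `x = (x₁, …, x_I)`. -/
abbrev Var (P : SPDProblem) : Type := (∀ i, Vec (P.n i)) × Vec P.n₀

/-- Indices of the inequality constraints: coupling, local, and those on `y`. -/
abbrev J (P : SPDProblem) : Type :=
  (Σ i, Fin (P.rt i)) ⊕ (Σ i, Fin (P.r i)) ⊕ Fin P.r₀

/-- Indices of the equality constraints. -/
abbrev M (P : SPDProblem) : Type := Σ i, Fin (P.m i)

/-- The affine equality constraint functions of block `i`. -/
def eqFun (P : SPDProblem) (i : Fin P.I) (xi : Vec (P.n i)) (y : Vec P.n₀) :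
    Fin (P.m i) → ℝ :=
  P.Ax i *ᵥ xi.ofLp + P.Ay i *ᵥ y.ofLp + P.b i

/-- The set `∏ X i × Y`. -/
def domain (P : SPDProblem) : Set P.Var := {p | (∀ i, p.1 i ∈ P.X i) ∧ p.2 ∈ P.Y}

/-- The nonconvex problem. -/
def toNLP (P : SPDProblem) : NLP P.Var P.J P.M where
  obj := fun p => P.f₀ p.2 + ∑ i, P.f i (p.1 i, p.2)
  ineq := Sum.elim (fun a p => P.gt a.1 (p.1 a.1, p.2) a.2)
    (Sum.elim (fun a p => P.g a.1 (p.1 a.1) a.2) (fun j p => P.g₀ p.2 j))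
  eqc := fun a p => P.eqFun a.1 (p.1 a.1) p.2 a.2
  dom := P.domain

/-- The assumptions on the problem. -/
structure Assumptions (P : SPDProblem) : Prop where
  X_nonempty : ∀ i, (P.X i).Nonempty
  X_closed : ∀ i, IsClosed (P.X i)
  X_convex : ∀ i, Convex ℝ (P.X i)
  U_open : ∀ i, IsOpen (P.U i)
  X_sub_U : ∀ i, P.X i ⊆ P.U i
  Y_nonempty : P.Y.Nonempty
  Y_closed : IsClosed P.Y
  Y_convex : Convex ℝ P.Y
  V_open : IsOpen P.V
  Y_sub_V : P.Y ⊆ P.V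
  f_contDiff : ∀ i, ContDiffOn ℝ 1 (P.f i) (P.U i ×ˢ P.V)
  f_lip : ∀ i, ∃ K, LipschitzOnWith K (fderiv ℝ (P.f i)) (P.X i ×ˢ P.Y)
  f₀_contDiff : ContDiffOn ℝ 1 P.f₀ P.V
  f₀_lip : ∃ K, LipschitzOnWith K (fderiv ℝ P.f₀) P.Y
  gt_contDiff : ∀ i, ContDiffOn ℝ 1 (P.gt i) (P.U i ×ˢ P.V)
  g_contDiff : ∀ i, ContDiffOn ℝ 1 (P.g i) (P.U i)
  g₀_contDiff : ContDiffOn ℝ 1 P.g₀ P.V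
  bddBelow : BddBelow (P.toNLP.obj '' P.toNLP.feasibleSet)

/-- Approximate functions; the last argument is the base point of the approximation.
`F i` splits into `Fx i` and `Fy i`, and `Gt i` into `Gx i` and the linear part `C i`. -/
structure Surrogates (P : SPDProblem) where
  F : ∀ i, Vec (P.n i) × Vec P.n₀ → Vec (P.n i) × Vec P.n₀ → ℝ
  F₀ : Vec P.n₀ → Vec P.n₀ → ℝ
  Gt : ∀ i, Vec (P.n i) × Vec P.n₀ → Vec (P.n i) × Vec P.n₀ → Fin (P.rt i) → ℝ
  G : ∀ i, Vec (P.n i) → Vec (P.n i) → Fin (P.r i) → ℝ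
  G₀ : Vec P.n₀ → Vec P.n₀ → Fin P.r₀ → ℝ
  Fx : ∀ i, Vec (P.n i) → Vec (P.n i) × Vec P.n₀ → ℝ
  Fy : ∀ i, Vec P.n₀ → Vec (P.n i) × Vec P.n₀ → ℝ
  Gx : ∀ i, Vec (P.n i) → Vec (P.n i) × Vec P.n₀ → Fin (P.rt i) → ℝ
  C : ∀ i, Vec (P.n i) × Vec P.n₀ → Matrix (Fin (P.rt i)) (Fin P.n₀) ℝ

namespace Surrogates

variable {P : SPDProblem}

/-- The approximate functions satisfy the standard requirements of successive convex
approximation. -/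
structure IsValid (S : P.Surrogates) : Prop where
  F : ∀ i, IsObjectiveSurrogate (P.U i ×ˢ P.V) (P.X i ×ˢ P.Y) (P.f i) (S.F i)
  F₀ : IsObjectiveSurrogate P.V P.Y P.f₀ S.F₀
  Gt : ∀ i, IsConstraintSurrogate (P.X i ×ˢ P.Y) (P.gt i) (S.Gt i)
  G : ∀ i, IsConstraintSurrogate (P.X i) (P.g i) (S.G i)
  G₀ : IsConstraintSurrogate P.Y P.g₀ S.G₀

/-- Separability in `x i` and `y` of the approximate objective functions. -/
structure ObjectiveSeparable (S : P.Surrogates) : Prop where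
  split : ∀ i, ∀ xi ∈ P.U i, ∀ y ∈ P.V, ∀ z ∈ P.X i ×ˢ P.Y,
    S.F i (xi, y) z = S.Fx i xi z + S.Fy i y z
  contDiff_x : ∀ i, ∀ z ∈ P.X i ×ˢ P.Y, ContDiffOn ℝ 1 (fun xi => S.Fx i xi z) (P.U i)
  contDiff_y : ∀ i, ∀ z ∈ P.X i ×ˢ P.Y, ContDiffOn ℝ 1 (fun y => S.Fy i y z) P.V

/-- Separability in `x i` and `y`, and linearity in `y`, of the approximate coupling
constraint functions. -/
structure ConstraintSeparable (S : P.Surrogates) : Prop where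
  split : ∀ i, ∀ xi ∈ P.U i, ∀ y ∈ P.V, ∀ z ∈ P.X i ×ˢ P.Y,
    S.Gt i (xi, y) z = S.Gx i xi z + S.C i z *ᵥ y.ofLp
  cont_x : ∀ i, ContinuousOn
    (fun p : Vec (P.n i) × (Vec (P.n i) × Vec P.n₀) => S.Gx i p.1 p.2)
    (P.U i ×ˢ (P.X i ×ˢ P.Y))
  cont_C : ∀ i, ContinuousOn (S.C i) (P.X i ×ˢ P.Y)

/-- The convex approximate problem at the base point `p`. -/
def approx (S : P.Surrogates) (p : P.Var) : NLP P.Var P.J P.M where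
  obj := fun q => S.F₀ q.2 p.2 + ∑ i, S.F i (q.1 i, q.2) (p.1 i, p.2)
  ineq := Sum.elim (fun a q => S.Gt a.1 (q.1 a.1, q.2) (p.1 a.1, p.2) a.2)
    (Sum.elim (fun a q => S.G a.1 (q.1 a.1) (p.1 a.1) a.2) (fun j q => S.G₀ q.2 p.2 j))
  eqc := fun a q => P.eqFun a.1 (q.1 a.1) q.2 a.2
  dom := P.domain

/-- The `i`-th convex subproblem, in the variable `x i`, at the base point `p` and for the
fixed value `y` of the coupling variable. -/
def sub (S : P.Surrogates) (p : P.Var) (i : Fin P.I) (y : Vec P.n₀) :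
    NLP (Vec (P.n i)) (Fin (P.rt i) ⊕ Fin (P.r i)) (Fin (P.m i)) where
  obj := fun xi => S.F i (xi, y) (p.1 i, p.2)
  ineq := Sum.elim (fun j xi => S.Gt i (xi, y) (p.1 i, p.2) j)
    (fun j xi => S.G i xi (p.1 i) j)
  eqc := fun l xi => P.eqFun i xi y l
  dom := P.X i

/-- The set cut out by the constraints `G₀ (y; p) ≤ 0` and `y ∈ Y` of the master problem. -/
def masterSet (S : P.Surrogates) (p : P.Var) : Set (Vec P.n₀) :=
  {y | y ∈ P.Y ∧ ∀ j, S.G₀ y p.2 j ≤ 0}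

/-- The values of `y` for which the objective function of the master problem is finite, that
is, for which all subproblems are feasible. -/
def masterDom (S : P.Surrogates) (p : P.Var) : Set (Vec P.n₀) :=
  {y | y ∈ P.V ∧ ∀ i, (S.sub p i y).feasibleSet.Nonempty}

end Surrogates

/-- The quantities that occur in one execution of the inner loop (primal decomposition);
`t : ℕ` counts its iterations. `mu t i` collects the multipliers of both groups of
inequality constraints of the `i`-th subproblem. -/
structure InnerTrace (P : SPDProblem) where
  step : ℕ → ℝ
  y : ℕ → Vec P.n₀
  x : ℕ → ∀ i, Vec (P.n i)
  mu : ℕ → ∀ i, Fin (P.rt i) ⊕ Fin (P.r i) → ℝ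
  lam : ℕ → ∀ i, Fin (P.m i) → ℝ

namespace InnerTrace

variable {P : SPDProblem}

/-- The subgradient `∇F₀ + ∑ i, (∇Fy i + (C i)ᵀ mu i + (Ay i)ᵀ lam i)` of the master
objective computed at inner iteration `t`. -/
def subgrad (T : P.InnerTrace) (S : P.Surrogates) (p : P.Var) (t : ℕ) : Vec P.n₀ :=
  gradient (fun y => S.F₀ y p.2) (T.y t) +
    ∑ i, (gradient (fun y => S.Fy i y (p.1 i, p.2)) (T.y t)
      + WithLp.toLp 2 ((S.C i (p.1 i, p.2))ᵀ *ᵥ fun j => T.mu t i (Sum.inl j))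
      + WithLp.toLp 2 ((P.Ay i)ᵀ *ᵥ T.lam t i))

/-- `T` is an execution of the projected-subgradient primal decomposition algorithm on the
convex approximate problem at the base point `p`. -/
structure IsRun (T : P.InnerTrace) (S : P.Surrogates) (p : P.Var) : Prop where
  step_pos : ∀ t, 0 < T.step t
  step_sum : Tendsto (fun N => ∑ t ∈ Finset.range N, T.step t) atTop atTop
  step_sq : Summable (fun t => T.step t ^ 2)
  init : T.y 0 = p.2
  x_opt : ∀ t i, (S.sub p i (T.y t)).IsOptimal (T.x t i)
  multipliers : ∀ t i, (S.sub p i (T.y t)).IsKKT (T.x t i) (T.mu t i) (T.lam t i)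
  /-- `y (t + 1)` is the Euclidean projection of the subgradient step onto the master set. -/
  y_mem : ∀ t, T.y (t + 1) ∈ S.masterSet p
  y_proj : ∀ t, ∀ c ∈ S.masterSet p,
    dist (T.y (t + 1)) (T.y t - T.step t • T.subgrad S p t) ≤
      dist c (T.y t - T.step t • T.subgrad S p t)

/-- The primal iterates of the inner loop. -/
def primal (T : P.InnerTrace) (t : ℕ) : P.Var := (T.x t, T.y t)

end InnerTrace

/-- `p`, `step` are the outer iterates and step sizes, and `T k` the executions of the inner
loop, in an execution of the successive primal decomposition algorithm. The outer step at `k`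
goes towards the point to which the `k`-th inner loop converges. That it converges is
not part of the definition. -/
structure IsSPDARun (P : SPDProblem) (S : P.Surrogates) (p : ℕ → P.Var) (step : ℕ → ℝ)
    (T : ℕ → P.InnerTrace) : Prop where
  init : p 0 ∈ P.toNLP.feasibleSet
  step_pos : ∀ k, 0 < step k
  step_le : ∀ k, step k ≤ 1
  step_lim : Tendsto step atTop (𝓝 0)
  step_sum : Tendsto (fun N => ∑ k ∈ Finset.range N, step k) atTop atTop
  inner_run : ∀ k, (T k).IsRun S (p k)
  update : ∀ k q, Tendsto (T k).primal atTop (𝓝 q) → p (k + 1) = p k + step k • (q - p k)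

end SPDProblem

end

/-! At its base point `p`, the approximate problem agrees with the original one to first order. Its
objective is strongly convex, uniformly in `p`, and its feasible set is a convex subset of the
original feasible set that contains `p` when `p` is feasible. Hence it has a unique optimal point,
and moving towards that point keeps the outer iterates feasible.

Inner loop. Let `z` be the inner iterate at `t`, `q` the optimal point, `s` the computed vector and
`φ` the approximate objective. The KKT conditions of the subproblems, convexity of the constraints
and linearity of the coupling in `y` give `⟨s, q.2 - z.2⟩ ≤ φ'(z) (q - z)` (`inner_subgrad_le`).
Strong convexity and optimality of `q` turn this into `⟨s, z.2 - q.2⟩ ≥ 2c ‖z - q‖²`. Since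
projection does not increase the distance to `q.2`, the squared distance of the `y`-iterates to
`q.2` is a contraction perturbed by `O(γ²)`, so it vanishes
(`tendsto_zero_of_perturbed_contraction`). The same inequality then forces the `x`-iterates to
converge. This needs `s` to be bounded, hence bounded multipliers: if they blew up along bounded
iterates, normalising them would yield in the limit nonzero Fritz John multipliers with objective
coefficient zero, at a regular point (`not_tendsto_atTop`).

Outer loop. The direction `q k - p k` is a descent direction for the true objective, so by the
descent lemma a step eventually decreases it by at least `c γ ‖q k - p k‖²`. Near a cluster point
`a` the directions cannot stay long: leaving a neighbourhood of `a` would cost more decrease than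
remains, and staying would cost an infinite amount (`frequently_small_of_mapClusterPt`). So some
iterates tend to `a` with `q k - p k → 0`. The points `q k` satisfy normalised Fritz John
conditions, by separation and without any constraint qualification; these pass to the limit, and
regularity of `a` makes the objective coefficient positive. Thus every cluster point is stationary.
-/

section Calculus

/-! ### First-order inequalities on convex sets. -/

variable {E : Type*} [NormedAddCommGroup E] [NormedSpace ℝ E]

theorem hasDerivAt_comp_line {f : E → ℝ} {u v : E} {t : ℝ}
    (hf : DifferentiableAt ℝ f (v + t • (u - v))) :
    HasDerivAt (fun s : ℝ => f (v + s • (u - v))) (fderiv ℝ f (v + t • (u - v)) (u - v)) t := by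
  have h : HasDerivAt (fun s : ℝ => v + s • (u - v)) (u - v) t := by
    simpa using ((hasDerivAt_id t).smul_const (u - v)).const_add v
  exact hf.hasFDerivAt.comp_hasDerivAt t h

/-- A function with strongly monotone derivative lies above its quadratic lower models. -/
theorem Convex.quadratic_lower_bound {X : Set E} (hX : Convex ℝ X) {f : E → ℝ} {c : ℝ}
    (hf : ∀ x ∈ X, DifferentiableAt ℝ f x)
    (hc : ∀ x ∈ X, ∀ v ∈ X, c * ‖x - v‖ ^ 2 ≤ (fderiv ℝ f x - fderiv ℝ f v) (x - v))
    {u v : E} (hu : u ∈ X) (hv : v ∈ X) :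
    f v + fderiv ℝ f v (u - v) + c / 2 * ‖u - v‖ ^ 2 ≤ f u := by
  set d := u - v with hd
  -- The claim is `φ 0 ≤ φ 1`. Strong monotonicity between `v + t • d` and `v`, divided by `t > 0`,
  -- says that the derivative of `φ` is nonnegative.
  let φ : ℝ → ℝ := fun t => f (v + t • d) - t * fderiv ℝ f v d - c / 2 * ‖d‖ ^ 2 * t ^ 2
  have hmem : ∀ t ∈ Icc (0 : ℝ) 1, v + t • d ∈ X := fun t ht => hX.add_smul_sub_mem hv hu ht
  have hder : ∀ t ∈ Icc (0 : ℝ) 1, HasDerivAt φ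
      (fderiv ℝ f (v + t • d) d - fderiv ℝ f v d - c * ‖d‖ ^ 2 * t) t := by
    intro t ht
    have h1 := hasDerivAt_comp_line (u := u) (hf _ (hmem t ht))
    have h2 := (hasDerivAt_id t).mul_const (fderiv ℝ f v d)
    have h3 := ((hasDerivAt_id t).pow 2).const_mul (c / 2 * ‖d‖ ^ 2)
    refine ((h1.sub h2).sub h3).congr_deriv ?_
    norm_num [hd]
    ring
  have hmono : MonotoneOn φ (Icc 0 1) := by
    refine monotoneOn_of_deriv_nonneg (convex_Icc 0 1)
      (fun t ht => (hder t ht).continuousAt.continuousWithinAt)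
      (fun t ht => (hder t (interior_subset ht)).differentiableAt.differentiableWithinAt) ?_
    intro t ht
    rw [interior_Icc] at ht
    have htI := Ioo_subset_Icc_self ht
    rw [(hder t htI).deriv]
    have h := hc _ (hmem t htI) v hv
    rw [add_sub_cancel_left, norm_smul, map_smul, Real.norm_of_nonneg ht.1.le,
      sub_apply, smul_eq_mul] at h
    have h' : t * (c * ‖d‖ ^ 2 * t) ≤ t * (fderiv ℝ f (v + t • d) d - fderiv ℝ f v d) := by
      linarith
    linarith [le_of_mul_le_mul_left h' ht.1]
  have h01 := hmono (left_mem_Icc.2 zero_le_one) (right_mem_Icc.2 zero_le_one) zero_le_one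
  simp only [φ, zero_smul, add_zero, one_smul, hd, add_sub_cancel] at h01
  linarith

/-- First-order characterization of convexity. -/
theorem ConvexOn.fderiv_le_sub {X : Set E} {g : E → ℝ} (hg : ConvexOn ℝ X g) {u v : E}
    (hu : u ∈ X) (hv : v ∈ X) (hd : DifferentiableAt ℝ g v) :
    g v + fderiv ℝ g v (u - v) ≤ g u := by
  have hmem : ∀ t ∈ Icc (0 : ℝ) 1, v + t • (u - v) ∈ X :=
    fun t ht => hg.1.add_smul_sub_mem hv hu ht
  have hconv : ConvexOn ℝ (Icc (0 : ℝ) 1) (fun t : ℝ => g (v + t • (u - v))) := by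
    refine ⟨convex_Icc 0 1, fun s hs t ht a b ha hb hab => ?_⟩
    have h := hg.2 (hmem s hs) (hmem t ht) ha hb hab
    convert h using 2
    have : v = (a + b) • v := by rw [hab, one_smul]
    nth_rewrite 1 [this]
    simp only [smul_eq_mul, smul_add, add_smul, mul_smul]
    abel
  have hder : HasDerivAt (fun t : ℝ => g (v + t • (u - v))) (fderiv ℝ g v (u - v)) 0 := by
    have := hasDerivAt_comp_line (f := g) (u := u) (v := v) (t := 0) (by simpa using hd)
    simpa using this
  have h := hconv.le_slope_of_hasDerivAt (left_mem_Icc.2 zero_le_one)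
    (right_mem_Icc.2 zero_le_one) zero_lt_one hder
  simp only [slope_def_field, one_smul, zero_smul, add_zero, sub_zero, div_one,
    add_sub_cancel] at h
  linarith

/-- First-order necessary condition for a minimum over a convex set. -/
theorem Convex.fderiv_nonneg_of_isMinOn {X : Set E} (hX : Convex ℝ X) {f : E → ℝ} {x v : E}
    (hx : x ∈ X) (hv : v ∈ X) (hmin : ∀ w ∈ X, f x ≤ f w) (hf : DifferentiableAt ℝ f x) :
    0 ≤ fderiv ℝ f x (v - x) :=
  (show IsMinOn f X x from hmin).localize.hasFDerivWithinAt_nonneg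
    hf.hasFDerivAt.hasFDerivWithinAt
    (sub_mem_posTangentConeAt_of_segment_subset (hX.segment_subset hx hv))

/-- The descent lemma. -/
theorem Convex.descent_of_lipschitzOnWith_fderiv {X : Set E} (hX : Convex ℝ X) {f : E → ℝ}
    {K : NNReal} (hf : ∀ x ∈ X, DifferentiableAt ℝ f x) (hK : LipschitzOnWith K (fderiv ℝ f) X)
    {u v : E} (hu : u ∈ X) (hv : v ∈ X) :
    f u ≤ f v + fderiv ℝ f v (u - v) + K * ‖u - v‖ ^ 2 := by
  have hseg : segment ℝ v u ⊆ X := hX.segment_subset hv hu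
  -- Mean value inequality for `f` minus its linearisation at `v`: on the segment the derivatives
  -- differ by at most `K * ‖u - v‖`. This yields `K` instead of the sharp `K / 2`, which is enough.
  have h := (convex_segment v u).norm_image_sub_le_of_norm_hasFDerivWithin_le'
    (f' := fderiv ℝ f) (φ := fderiv ℝ f v) (C := K * ‖u - v‖)
    (fun x hx => (hf x (hseg hx)).hasFDerivAt.hasFDerivWithinAt)
    (fun x hx => (hK.norm_sub_le (hseg hx) hv).trans
      (mul_le_mul_of_nonneg_left (norm_sub_le_of_mem_segment hx) K.2))
    (left_mem_segment ℝ v u) (right_mem_segment ℝ v u)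
  have h' := (le_abs_self _).trans h
  nlinarith

end Calculus

/-! ### Weak separation in finite dimension. -/

section Separation

variable {W : Type*} [NormedAddCommGroup W] [NormedSpace ℝ W] [FiniteDimensional ℝ W]

/-- In a finite-dimensional space a convex set can be weakly separated from any point outside
it, here the origin. -/
theorem Convex.exists_dual_ne_zero_nonneg {A : Set W} (hA : Convex ℝ A) (h0 : (0 : W) ∉ A)
    (hne : A.Nonempty) : ∃ f : W →L[ℝ] ℝ, f ≠ 0 ∧ ∀ a ∈ A, 0 ≤ f a := by
  by_cases hint : (interior A).Nonempty
  · obtain ⟨f, u, hf, hfA, hfu⟩ := geometric_hahn_banach_of_nonempty_interior hA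
      (convex_singleton (0 : W)) (disjoint_singleton_right.2 fun h => h0 (interior_subset h))
      hint (singleton_nonempty _)
    have hu : u ≤ 0 := by simpa using hfu 0 rfl
    refine ⟨-f, neg_ne_zero.2 hf, fun a ha => ?_⟩
    have := hfA a ha
    simp only [neg_apply]
    linarith
  -- With empty interior, `A` lies in a proper affine subspace. A nonzero functional that kills its
  -- direction is constant on `A`, and one of the two signs makes it nonnegative.
  · obtain ⟨a₀, ha₀⟩ := hne
    have hspan : affineSpan ℝ A ≠ ⊤ := fun h =>
      hint ((hA.interior_nonempty_iff_affineSpan_eq_top).2 h)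
    have hdir : (affineSpan ℝ A).direction ≠ ⊤ := by
      intro h
      exact hspan ((AffineSubspace.direction_eq_top_iff_of_nonempty
        ⟨a₀, subset_affineSpan ℝ A ha₀⟩).1 h)
    obtain ⟨g, hg, hgd⟩ := Submodule.exists_le_ker_of_lt_top _ (lt_top_iff_ne_top.2 hdir)
    have hconst : ∀ a ∈ A, g a = g a₀ := by
      intro a ha
      have : a -ᵥ a₀ ∈ (affineSpan ℝ A).direction :=
        AffineSubspace.vsub_mem_direction (subset_affineSpan ℝ A ha) (subset_affineSpan ℝ A ha₀)
      have := LinearMap.mem_ker.1 (hgd this)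
      rw [vsub_eq_sub, map_sub] at this
      linarith
    have hG : LinearMap.toContinuousLinearMap g ≠ 0 := by simpa using hg
    rcases le_total 0 (g a₀) with h | h
    · exact ⟨LinearMap.toContinuousLinearMap g, hG, fun a ha => by
        simpa [hconst a ha] using h⟩
    · exact ⟨-LinearMap.toContinuousLinearMap g, neg_ne_zero.2 hG, fun a ha => by
        simpa [hconst a ha] using h⟩

end Separation

/-! ### Two convergence principles for real sequences with divergent step sums. -/

section Sequences

/-- Convergence to zero of a perturbed linear contraction with non-summable rates and summable
perturbations. -/
theorem tendsto_zero_of_perturbed_contraction {a γ : ℕ → ℝ} {κ B : ℝ} (hκ : 0 < κ) (hB : 0 ≤ B)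
    (ha : ∀ t, 0 ≤ a t) (hγ : ∀ t, 0 < γ t)
    (hsum : Tendsto (fun N => ∑ t ∈ Finset.range N, γ t) atTop atTop)
    (hsq : Summable (fun t => γ t ^ 2))
    (hstep : ∀ t, a (t + 1) ≤ a t - κ * γ t * a t + γ t ^ 2 * B) :
    Tendsto a atTop (𝓝 0) := by
  let r : ℕ → ℝ := fun t => ∑ s ∈ Finset.range t, γ s ^ 2 * B
  have hr : Tendsto r atTop (𝓝 (∑' s, γ s ^ 2 * B)) := (hsq.mul_right B).hasSum.tendsto_sum_nat
  set R := ∑' s, γ s ^ 2 * B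
  -- Subtracting the accumulated perturbations leaves a monotone bounded sequence, so `a` converges.
  -- Only `a ≥ 0` is used for this, not `κ * γ t ≤ 1`.
  let e : ℕ → ℝ := fun t => a t - r t
  have hrle : ∀ t, r t ≤ R := fun t =>
    (hsq.mul_right B).sum_le_tsum _ fun s _ => mul_nonneg (sq_nonneg _) hB
  have hestep : ∀ t, e (t + 1) ≤ e t - κ * γ t * a t := by
    intro t
    simp only [e, r, Finset.sum_range_succ]
    linarith [hstep t]
  have hanti : Antitone e := antitone_nat_of_succ_le fun t => by
    have := mul_nonneg (mul_pos hκ (hγ t)).le (ha t)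
    linarith [hestep t]
  have hbdd : BddBelow (range e) := ⟨-R, by
    rintro _ ⟨t, rfl⟩
    have := ha t
    have := hrle t
    simp only [e]
    linarith⟩
  obtain ⟨l, hl⟩ : ∃ l, Tendsto e atTop (𝓝 l) := ⟨_, tendsto_atTop_ciInf hanti hbdd⟩
  have hal : Tendsto a atTop (𝓝 (l + R)) := by
    have := hl.add hr
    simpa [e] using this
  have hL : 0 ≤ l + R := ge_of_tendsto' hal ha
  rcases hL.eq_or_lt with h | h
  · rwa [h]
  -- With a positive limit, `a` eventually exceeds half of it, and the losses `κ * γ t * a t` have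
  -- infinite sum.
  exfalso
  obtain ⟨N, hN⟩ := eventually_atTop.1 (hal.eventually_const_lt (half_lt_self h))
  set m := (l + R) / 2
  have hm : 0 < κ * m := mul_pos hκ (half_pos h)
  have htel : ∀ n, N ≤ n → e n + κ * m * (∑ t ∈ Finset.range n, γ t) ≤
      e N + κ * m * ∑ t ∈ Finset.range N, γ t := by
    intro n hn
    induction n, hn using Nat.le_induction with
    | base => exact le_rfl
    | succ n hn ih =>
      rw [Finset.sum_range_succ]
      have h1 := hestep n
      have h2 : κ * γ n * m ≤ κ * γ n * a n :=
        mul_le_mul_of_nonneg_left (hN n hn).le (mul_pos hκ (hγ n)).le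
      nlinarith
  obtain ⟨n, hn, hNn⟩ := ((hsum.const_mul_atTop hm).eventually_gt_atTop
    (e N + κ * m * ∑ t ∈ Finset.range N, γ t + R)).and (eventually_ge_atTop N) |>.exists
  have h1 := htel n hNn
  have h2 : -R ≤ e n := by
    have := ha n
    have := hrle n
    simp only [e]
    linarith
  linarith

/-- If the values decrease at the rate of step size times squared direction length, then near
every cluster point of the iterates there are iterates with short directions. -/
theorem frequently_small_of_mapClusterPt {E : Type*} [PseudoMetricSpace E] {p : ℕ → E}
    {f γ d : ℕ → ℝ} {κ : ℝ} (hκ : 0 < κ) (hd : ∀ k, 0 ≤ d k) (hγ : ∀ k, 0 < γ k)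
    (hsum : Tendsto (fun N => ∑ k ∈ Finset.range N, γ k) atTop atTop)
    (hbdd : BddBelow (range f))
    (hstep : ∀ᶠ k in atTop, f (k + 1) ≤ f k - κ * γ k * d k ^ 2)
    (hdist : ∀ k, dist (p (k + 1)) (p k) ≤ γ k * d k)
    {a : E} (ha : MapClusterPt a atTop p) {δ ε : ℝ} (hδ : 0 < δ) (hε : 0 < ε) :
    ∃ᶠ k in atTop, dist (p k) a < δ ∧ d k < ε := by
  by_contra hcon
  rw [not_frequently] at hcon
  obtain ⟨N, hN⟩ := eventually_atTop.1 (hstep.and hcon)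
  have hanti : ∀ m n, N ≤ m → m ≤ n → f n ≤ f m := by
    intro m n hm hmn
    induction n, hmn using Nat.le_induction with
    | base => exact le_rfl
    | succ n hn ih =>
      have h1 := (hN n (hm.trans hn)).1
      have h2 := mul_nonneg (mul_pos hκ (hγ n)).le (sq_nonneg (d n))
      linarith
  obtain ⟨b, hb⟩ := hbdd
  have hb' : ∀ k, b ≤ f k := fun k => hb ⟨k, rfl⟩
  -- from some index on, the total decrease is small
  obtain ⟨N₁, hNN₁, hN₁⟩ : ∃ N₁, N ≤ N₁ ∧ ∀ k, N₁ ≤ k → f N₁ - f k < κ * ε * (δ / 2) := by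
    let g : ℕ → ℝ := fun k => f (k + N)
    have hg : Antitone g := fun m n hmn => hanti _ _ (by omega) (by omega)
    have hlim := tendsto_atTop_ciInf hg ⟨b, by rintro _ ⟨k, rfl⟩; exact hb' _⟩
    have hη : 0 < κ * ε * (δ / 2) := by positivity
    obtain ⟨M, hM⟩ := (hlim.eventually_lt_const (lt_add_of_pos_right _ hη)).exists
    refine ⟨M + N, by omega, fun k hk => ?_⟩
    have : (⨅ i, g i) ≤ g (k - N) := ciInf_le ⟨b, by rintro _ ⟨k, rfl⟩; exact hb' _⟩ _
    have hk' : g (k - N) = f k := by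
      simp only [g]
      congr 1
      omega
    have hM' : f (M + N) < (⨅ i, g i) + κ * ε * (δ / 2) := hM
    linarith
  obtain ⟨k₀, hk₀, hk₀N⟩ := ((ha.frequently (Metric.ball_mem_nhds a (half_pos hδ))).and_eventually
    (eventually_ge_atTop N₁)).exists
  have hlong : ∀ k, N ≤ k → dist (p k) a < δ → ε ≤ d k := fun k hk hka =>
    not_lt.1 fun h => (hN k hk).2 ⟨hka, h⟩
  have hκε : 0 < κ * ε := mul_pos hκ hε
  -- While `d k ≥ ε`, the decrease `κ γ d²` is at least `κ ε` times the distance travelled. The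
  -- remaining decrease is below `κ ε δ / 2`, so the iterates, started within `δ / 2` of `a`, stay
  -- in the `δ`-ball, which in turn keeps `d k ≥ ε`.
  have hball : ∀ k, k₀ ≤ k → κ * ε * dist (p k) (p k₀) ≤ f k₀ - f k := by
    intro k hk
    induction k, hk using Nat.le_induction with
    | base => simp
    | succ k hk ih =>
      have hdec : f N₁ - f k < κ * ε * (δ / 2) := hN₁ k (hk₀N.trans hk)
      have hle : f k₀ ≤ f N₁ := hanti _ _ hNN₁ hk₀N
      have hnear : dist (p k) (p k₀) < δ / 2 := by
        refine lt_of_mul_lt_mul_left ?_ hκε.le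
        linarith
      have hka : dist (p k) a < δ := by linarith [dist_triangle (p k) (p k₀) a]
      have hεd := hlong k (by omega) hka
      have h1 := (hN k (by omega)).1
      have h2 := dist_triangle (p (k + 1)) (p k) (p k₀)
      have h3 := hdist k
      have h4 : κ * ε * (γ k * d k) ≤ κ * γ k * d k ^ 2 := by
        have := mul_le_mul_of_nonneg_left hεd (mul_nonneg (mul_pos hκ (hγ k)).le (hd k))
        linarith
      have h5 : κ * ε * dist (p (k + 1)) (p k₀) ≤ κ * ε * (γ k * d k + dist (p k) (p k₀)) :=
        mul_le_mul_of_nonneg_left (by linarith) hκε.le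
      linarith
  -- The iterates being trapped, every further step loses at least `κ ε² γ k`, and these losses sum
  -- to infinity.
  have htel : ∀ k, k₀ ≤ k → f k + κ * ε ^ 2 * (∑ t ∈ Finset.range k, γ t) ≤
      f k₀ + κ * ε ^ 2 * ∑ t ∈ Finset.range k₀, γ t := by
    intro k hk
    induction k, hk using Nat.le_induction with
    | base => exact le_rfl
    | succ k hk ih =>
      rw [Finset.sum_range_succ]
      have hdec : f N₁ - f k < κ * ε * (δ / 2) := hN₁ k (hk₀N.trans hk)
      have hle : f k₀ ≤ f N₁ := hanti _ _ hNN₁ hk₀N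
      have hnear : dist (p k) (p k₀) < δ / 2 := by
        refine lt_of_mul_lt_mul_left ?_ hκε.le
        linarith [hball k hk]
      have hεd := hlong k (by omega) (by linarith [dist_triangle (p k) (p k₀) a])
      have h1 := (hN k (by omega)).1
      have h2 : κ * γ k * ε ^ 2 ≤ κ * γ k * d k ^ 2 :=
        mul_le_mul_of_nonneg_left (pow_le_pow_left₀ hε.le hεd 2) (mul_pos hκ (hγ k)).le
      nlinarith
  have hm : 0 < κ * ε ^ 2 := by positivity
  obtain ⟨n, hn, hkn⟩ := ((hsum.const_mul_atTop hm).eventually_gt_atTop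
    (f k₀ + κ * ε ^ 2 * ∑ t ∈ Finset.range k₀, γ t - b)).and (eventually_ge_atTop k₀) |>.exists
  linarith [htel n hkn, hb' n]

end Sequences

/-! ### Fritz John conditions: limits, regularity, and existence for convex problems. -/

namespace NLP

variable {E J M : Type} [NormedAddCommGroup E] [NormedSpace ℝ E] [Fintype J] [Fintype M]

/-- The Fritz John conditions at `x`: the KKT conditions with a multiplier `m₀` for the objective
function. -/
structure IsFritzJohn (P : NLP E J M) (x : E) (m₀ : ℝ) (mu : J → ℝ) (lam : M → ℝ) : Prop where
  stationary : ∀ v ∈ P.dom, 0 ≤ (m₀ • fderiv ℝ P.obj x + ∑ j, mu j • fderiv ℝ (P.ineq j) x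
      + ∑ l, lam l • fderiv ℝ (P.eqc l) x) (v - x)
  compl : ∀ j, mu j * P.ineq j x = 0
  nonneg₀ : 0 ≤ m₀
  nonneg : ∀ j, 0 ≤ mu j
  feasible : x ∈ P.feasibleSet

variable {P : NLP E J M} {x : E} {m₀ : ℝ} {mu : J → ℝ} {lam : M → ℝ}

theorem IsKKT.isFritzJohn (h : P.IsKKT x mu lam) : P.IsFritzJohn x 1 mu lam :=
  ⟨by simpa only [one_smul] using h.1, h.2.1, zero_le_one, h.2.2.1, h.2.2.2⟩

theorem IsFritzJohn.smul (h : P.IsFritzJohn x m₀ mu lam) {r : ℝ} (hr : 0 ≤ r) :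
    P.IsFritzJohn x (r * m₀) (r • mu) (r • lam) where
  stationary v hv := by
    have := mul_nonneg hr (h.stationary v hv)
    simp only [Pi.smul_apply, smul_eq_mul, mul_smul, ← Finset.smul_sum, ← smul_add]
    simpa only [smul_apply, smul_eq_mul] using this
  compl j := by simp [mul_assoc, h.compl j]
  nonneg₀ := mul_nonneg hr h.nonneg₀
  nonneg j := mul_nonneg hr (h.nonneg j)
  feasible := h.feasible

theorem IsFritzJohn.isKKT (h : P.IsFritzJohn x m₀ mu lam) (hm : 0 < m₀) :
    P.IsKKT x (m₀⁻¹ • mu) (m₀⁻¹ • lam) := by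
  have h' := h.smul (inv_nonneg.2 hm.le)
  rw [inv_mul_cancel₀ hm.ne'] at h'
  exact ⟨by simpa only [one_smul] using h'.stationary, h'.compl, h'.nonneg, h'.feasible⟩

/-- With `m₀ = 0` the conditions are exactly the hypotheses of the dual constraint qualification,
which would annihilate all multipliers and contradict the normalisation. -/
theorem IsFritzJohn.pos_of_MFCQ (h : P.IsFritzJohn x m₀ mu lam)
    (hne : ‖(m₀, mu, lam)‖ = 1) (hreg : P.MFCQ x) : 0 < m₀ := by
  refine h.nonneg₀.lt_of_ne fun h0 => ?_
  subst h0
  obtain ⟨rfl, rfl⟩ := hreg mu lam (by simpa only [zero_smul, zero_add] using h.stationary)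
    h.nonneg fun j hj => (mul_eq_zero.1 (h.compl j)).resolve_right hj
  rw [← Prod.zero_eq_mk, ← Prod.zero_eq_mk, norm_zero] at hne
  exact zero_ne_one hne

/-- The problems `Q n`, looked at near `x n`, converge to the problem `P`, looked at near `a`,
to first order. -/
structure ConvergesTo (Q : ℕ → NLP E J M) (x : ℕ → E) (P : NLP E J M) (a : E) : Prop where
  dom : ∀ n, (Q n).dom = P.dom
  feasible : a ∈ P.feasibleSet
  point : Tendsto x atTop (𝓝 a)
  obj : Tendsto (fun n => fderiv ℝ (Q n).obj (x n)) atTop (𝓝 (fderiv ℝ P.obj a))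
  ineq : ∀ j, Tendsto (fun n => (Q n).ineq j (x n)) atTop (𝓝 (P.ineq j a))
  ineq' : ∀ j, Tendsto (fun n => fderiv ℝ ((Q n).ineq j) (x n)) atTop
    (𝓝 (fderiv ℝ (P.ineq j) a))
  eqc' : ∀ l, Tendsto (fun n => fderiv ℝ ((Q n).eqc l) (x n)) atTop
    (𝓝 (fderiv ℝ (P.eqc l) a))

/-- Limits of normalised Fritz John multipliers are Fritz John multipliers of the limit. -/
theorem ConvergesTo.exists_isFritzJohn {Q : ℕ → NLP E J M} {x : ℕ → E} {a : E}
    (hc : ConvergesTo Q x P a) {w : ℕ → ℝ × (J → ℝ) × (M → ℝ)} (hw : ∀ n, ‖w n‖ = 1)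
    (h : ∀ n, (Q n).IsFritzJohn (x n) (w n).1 (w n).2.1 (w n).2.2) :
    ∃ u : ℝ × (J → ℝ) × (M → ℝ), ‖u‖ = 1 ∧ P.IsFritzJohn a u.1 u.2.1 u.2.2 ∧
      MapClusterPt u atTop w := by
  -- Compactness of the unit sphere provides a limit that is still nonzero; each condition then
  -- passes to it separately.
  obtain ⟨u, hu, φ, hφ, hlim⟩ := (isCompact_sphere (0 : ℝ × (J → ℝ) × (M → ℝ)) 1).tendsto_subseq
    (x := w) fun n => by simpa using hw n
  have hφ' := hφ.tendsto_atTop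
  have h0 : Tendsto (fun n => (w (φ n)).1) atTop (𝓝 u.1) := (continuous_fst.tendsto u).comp hlim
  have h1 : ∀ j, Tendsto (fun n => (w (φ n)).2.1 j) atTop (𝓝 (u.2.1 j)) := fun j =>
    ((continuous_apply j).comp (continuous_fst.comp continuous_snd)).tendsto u |>.comp hlim
  have h2 : ∀ l, Tendsto (fun n => (w (φ n)).2.2 l) atTop (𝓝 (u.2.2 l)) := fun l =>
    ((continuous_apply l).comp (continuous_snd.comp continuous_snd)).tendsto u |>.comp hlim
  refine ⟨u, by simpa using hu, ⟨fun v hv => ?_, fun j => ?_, ?_, fun j => ?_, hc.feasible⟩,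
    MapClusterPt.of_comp hφ' hlim.mapClusterPt⟩
  · have hD := ((h0.smul (hc.obj.comp hφ')).add
      (tendsto_finsetSum Finset.univ fun j _ => (h1 j).smul ((hc.ineq' j).comp hφ'))).add
      (tendsto_finsetSum Finset.univ fun l _ => (h2 l).smul ((hc.eqc' l).comp hφ'))
    have hv' : Tendsto (fun n => v - x (φ n)) atTop (𝓝 (v - a)) :=
      (hc.point.comp hφ').const_sub v
    refine ge_of_tendsto' ((isBoundedBilinearMap_apply.continuous.tendsto _).comp
      (hD.prodMk_nhds hv')) fun n => ?_
    exact (h (φ n)).stationary v (by rw [hc.dom]; exact hv)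
  · refine tendsto_nhds_unique ((h1 j).mul ((hc.ineq j).comp hφ')) ?_
    simp only [Function.comp_apply, (h _).compl, tendsto_const_nhds_iff]
  · exact ge_of_tendsto' h0 fun n => (h _).nonneg₀
  · exact ge_of_tendsto' (h1 j) fun n => (h _).nonneg j

/-- Regularity is needed at the limit point only: the approximating problems supply normalised Fritz
John multipliers, whose objective coefficient may vanish. -/
theorem ConvergesTo.isStationary {Q : ℕ → NLP E J M} {x : ℕ → E} {a : E}
    (hc : ConvergesTo Q x P a) (hreg : P.MFCQ a)
    (h : ∀ n, ∃ w : ℝ × (J → ℝ) × (M → ℝ), ‖w‖ = 1 ∧ (Q n).IsFritzJohn (x n) w.1 w.2.1 w.2.2) :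
    P.IsStationary a := by
  choose w hw h using h
  obtain ⟨u, hu, hFJ, -⟩ := hc.exists_isFritzJohn hw h
  exact ⟨_, _, hFJ.isKKT (hFJ.pos_of_MFCQ hu hreg)⟩

/-- Multipliers cannot blow up in the approach to a regular point. -/
theorem ConvergesTo.not_tendsto_atTop {Q : ℕ → NLP E J M} {x : ℕ → E} {a : E}
    (hc : ConvergesTo Q x P a) (hreg : P.MFCQ a) {mu : ℕ → J → ℝ} {lam : ℕ → M → ℝ}
    (h : ∀ n, (Q n).IsKKT (x n) (mu n) (lam n)) :
    ¬ Tendsto (fun n => ‖(mu n, lam n)‖) atTop atTop := by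
  intro hlim
  -- After normalisation of `(1, mu, lam)` the objective coefficient is `‖z n‖⁻¹`, which tends to
  -- zero, so the limiting multipliers have `u.1 = 0`.
  let z : ℕ → ℝ × (J → ℝ) × (M → ℝ) := fun n => (1, mu n, lam n)
  have hz : ∀ n, 1 ≤ ‖z n‖ := fun n => by
    simp [z]
  have hz' : Tendsto (fun n => ‖z n‖) atTop atTop :=
    tendsto_atTop_mono (fun n => norm_snd_le (z n)) hlim
  obtain ⟨u, hu, hFJ, hcl⟩ := hc.exists_isFritzJohn (w := fun n => ‖z n‖⁻¹ • z n)
    (fun n => by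
      rw [norm_smul, norm_inv, norm_norm, inv_mul_cancel₀ (zero_lt_one.trans_le (hz n)).ne'])
    (fun n => (h n).isFritzJohn.smul (inv_nonneg.2 (norm_nonneg _)))
  have h0 : Tendsto (fun n => (‖z n‖⁻¹ • z n).1) atTop (𝓝 0) := by
    refine hz'.inv_tendsto_atTop.congr fun n => ?_
    simp [z]
  have hcl' : MapClusterPt u.1 atTop (fun n => (‖z n‖⁻¹ • z n).1) :=
    hcl.continuousAt_comp continuous_fst.continuousAt
  have hu0 : u.1 = 0 := by
    by_contra hne
    obtain ⟨s, t, hs, ht, hst⟩ := t2_separation_nhds hne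
    obtain ⟨n, hn1, hn2⟩ := ((hcl'.frequently hs).and_eventually (h0 ht)).exists
    exact disjoint_left.1 hst hn1 hn2
  exact (hFJ.pos_of_MFCQ hu hreg).ne' hu0

/-- A convex problem with affine equality constraints satisfies the Fritz John conditions at
every feasible point at which the objective function has no feasible descent direction. -/
theorem exists_isFritzJohn {L : M → E →L[ℝ] ℝ} (hdom : Convex ℝ P.dom)
    (hineq : ∀ j, ConvexOn ℝ P.dom (P.ineq j))
    (hdiff : ∀ j, DifferentiableAt ℝ (P.ineq j) x)
    (hL : ∀ l u v, P.eqc l u - P.eqc l v = L l (u - v))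
    (hx : x ∈ P.feasibleSet) (hmin : ∀ v ∈ P.feasibleSet, 0 ≤ fderiv ℝ P.obj x (v - x)) :
    ∃ w : ℝ × (J → ℝ) × (M → ℝ), ‖w‖ = 1 ∧ P.IsFritzJohn x w.1 w.2.1 w.2.2 := by
  classical
  set φ := fderiv ℝ P.obj x with hφ
  have hLx : ∀ l u, P.eqc l u = L l (u - x) := fun l u => by
    have := hL l u x
    rwa [hx.2.2 l, sub_zero] at this
  have haff : ∀ (ψ : E →L[ℝ] ℝ) (u v : E) (a b : ℝ), a + b = 1 →
      ψ (a • u + b • v - x) = a * ψ (u - x) + b * ψ (v - x) := by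
    intro ψ u v a b hab
    simp only [map_sub, map_add, map_smul, smul_eq_mul]
    linear_combination (ψ x) * hab
  -- The values attained by the linearised objective and the constraints, enlarged upwards in the
  -- first two components. Absence of feasible descent directions means that `0 ∉ A`; the
  -- coordinates of a separating functional are the multipliers.
  let A : Set (ℝ × (J → ℝ) × (M → ℝ)) := {w | ∃ v ∈ P.dom, φ (v - x) < w.1 ∧
    (∀ j, P.ineq j v ≤ w.2.1 j) ∧ ∀ l, P.eqc l v = w.2.2 l}
  have hA : Convex ℝ A := by
    rintro w ⟨v, hv, h1, h2, h3⟩ w' ⟨v', hv', h1', h2', h3'⟩ a b ha hb hab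
    refine ⟨a • v + b • v', hdom hv hv' ha hb hab, ?_, fun j => ?_, fun l => ?_⟩
    · rw [haff φ _ _ _ _ hab]
      simp only [Prod.fst_add, Prod.smul_fst, smul_eq_mul]
      rcases ha.eq_or_lt with rfl | ha
      · have : b = 1 := by linarith
        subst this
        linarith
      · have := mul_lt_mul_of_pos_left h1 ha
        have := mul_le_mul_of_nonneg_left h1'.le hb
        linarith
    · have := (hineq j).2 hv hv' ha hb hab
      have := mul_le_mul_of_nonneg_left (h2 j) ha
      have := mul_le_mul_of_nonneg_left (h2' j) hb
      simp only [Prod.snd_add, Prod.smul_snd, Prod.fst_add, Prod.smul_fst, Pi.add_apply,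
        Pi.smul_apply, smul_eq_mul] at *
      linarith
    · simp only [hLx] at h3 h3' ⊢
      rw [haff _ _ _ _ _ hab, h3, h3']
      simp
  have h0 : (0 : ℝ × (J → ℝ) × (M → ℝ)) ∉ A := by
    rintro ⟨v, hv, h1, h2, h3⟩
    exact absurd (hmin v ⟨hv, h2, h3⟩) (not_le.2 h1)
  have hmemA : ∀ v ∈ P.dom, ∀ ε : ℝ, 0 < ε → ∀ s : J → ℝ, (∀ j, 0 ≤ s j) →
      ((φ (v - x) + ε, (fun j => P.ineq j v + s j), fun l => P.eqc l v) :
        ℝ × (J → ℝ) × (M → ℝ)) ∈ A :=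
    fun v hv ε hε s hs => ⟨v, hv, by simpa using hε, fun j => by simpa using hs j, fun l => rfl⟩
  obtain ⟨f, hf, hfA⟩ := hA.exists_dual_ne_zero_nonneg h0
    ⟨_, hmemA x hx.1 1 zero_lt_one 0 fun _ => le_rfl⟩
  let m₀ : ℝ := f (1, 0, 0)
  let mu : J → ℝ := fun j => f (0, Pi.single j 1, 0)
  let lam : M → ℝ := fun l => f (0, 0, Pi.single l 1)
  have hfw : ∀ (r : ℝ) (s : J → ℝ) (t : M → ℝ),
      f (r, s, t) = m₀ * r + ∑ j, mu j * s j + ∑ l, lam l * t l := by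
    intro r s t
    have h1 : f (r, 0, 0) = m₀ * r := by
      have : ((r, 0, 0) : ℝ × (J → ℝ) × (M → ℝ)) = r • (1, 0, 0) := by simp
      rw [this, map_smul, smul_eq_mul, mul_comm]
    have h2 : f (0, s, 0) = ∑ j, mu j * s j := by
      have := LinearMap.pi_apply_eq_sum_univ (f.toLinearMap ∘ₗ
        (LinearMap.inr ℝ ℝ ((J → ℝ) × (M → ℝ)) ∘ₗ LinearMap.inl ℝ (J → ℝ) (M → ℝ))) s
      simp only [LinearMap.comp_apply, LinearMap.inr_apply, LinearMap.inl_apply,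
        ContinuousLinearMap.coe_coe, smul_eq_mul] at this
      rw [this]
      refine Finset.sum_congr rfl fun j _ => ?_
      rw [mul_comm]
      congr 4
      ext i
      simp [Pi.single_apply, eq_comm]
    have h3 : f (0, 0, t) = ∑ l, lam l * t l := by
      have := LinearMap.pi_apply_eq_sum_univ (f.toLinearMap ∘ₗ
        (LinearMap.inr ℝ ℝ ((J → ℝ) × (M → ℝ)) ∘ₗ LinearMap.inr ℝ (J → ℝ) (M → ℝ))) t
      simp only [LinearMap.comp_apply, LinearMap.inr_apply,
        ContinuousLinearMap.coe_coe, smul_eq_mul] at this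
      rw [this]
      refine Finset.sum_congr rfl fun j _ => ?_
      rw [mul_comm]
      congr 4
      ext i
      simp [Pi.single_apply, eq_comm]
    rw [← h1, ← h2, ← h3, ← map_add, ← map_add]
    simp
  have hge : ∀ v ∈ P.dom, ∀ ε : ℝ, 0 < ε → ∀ s : J → ℝ, (∀ j, 0 ≤ s j) →
      0 ≤ m₀ * (φ (v - x) + ε) + ∑ j, mu j * (P.ineq j v + s j)
        + ∑ l, lam l * P.eqc l v := by
    intro v hv ε hε s hs
    rw [← hfw]
    exact hfA _ (hmemA v hv ε hε s hs)
  -- The first component of points of `A` can be raised at will, so a negative coefficient would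
  -- make the functional negative; the slack below contributes exactly `-(|c| + 1)`. The same
  -- argument gives `hmu`.
  have hm₀ : 0 ≤ m₀ := by
    by_contra hneg
    push Not at hneg
    set c := ∑ j, mu j * (P.ineq j x + 0) + ∑ l, lam l * P.eqc l x with hc
    have h := hge x hx.1 ((|c| + 1) / -m₀) (by have := abs_nonneg c; apply div_pos <;> linarith)
      (fun _ => 0) fun _ => le_rfl
    have h' : m₀ * ((|c| + 1) / -m₀) = -(|c| + 1) := by
      rw [div_neg, mul_neg, mul_div_cancel₀ _ hneg.ne]
    rw [sub_self, map_zero, zero_add, h'] at h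
    linarith [le_abs_self c]
  have hmu : ∀ j, 0 ≤ mu j := by
    intro j
    by_contra hneg
    push Not at hneg
    set c := m₀ * (φ (x - x) + 1) + ∑ j, mu j * P.ineq j x + ∑ l, lam l * P.eqc l x with hc
    have hs : 0 ≤ (|c| + 1) / -mu j := by
      have := abs_nonneg c
      apply div_nonneg <;> linarith
    have h := hge x hx.1 1 one_pos (Pi.single j ((|c| + 1) / -mu j)) (fun i => by
      rcases eq_or_ne i j with rfl | hij
      · simpa using hs
      · simp [hij])
    have h' : mu j * ((|c| + 1) / -mu j) = -(|c| + 1) := by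
      rw [div_neg, mul_neg, mul_div_cancel₀ _ hneg.ne]
    simp only [mul_add, Finset.sum_add_distrib, Pi.single_apply, mul_ite, mul_zero,
      Finset.sum_ite_eq', Finset.mem_univ, if_true, h'] at h
    simp only [mul_add] at hc
    linarith [le_abs_self c]
  have hlag : ∀ v ∈ P.dom, 0 ≤ m₀ * φ (v - x) + ∑ j, mu j * P.ineq j v
      + ∑ l, lam l * P.eqc l v := by
    intro v hv
    refine le_of_forall_pos_le_add fun ε hε => ?_
    have h := hge v hv (ε / (m₀ + 1)) (by positivity) (fun _ => 0) fun _ => le_rfl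
    have h' : m₀ * (ε / (m₀ + 1)) ≤ ε := by
      rw [mul_div_assoc', div_le_iff₀ (by positivity)]
      nlinarith
    simp only [add_zero, mul_add] at h
    linarith
  -- At `v = x` the inequality `hlag` bounds from below by zero a sum of nonpositive terms.
  have hcompl : ∀ j, mu j * P.ineq j x = 0 := by
    have h := hlag x hx.1
    simp only [sub_self, map_zero, mul_zero, zero_add, hx.2.2, Finset.sum_const_zero,
      add_zero] at h
    have hle : ∀ j ∈ Finset.univ, mu j * P.ineq j x ≤ 0 := fun j _ =>
      mul_nonpos_of_nonneg_of_nonpos (hmu j) (hx.2.1 j)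
    have hsum : ∑ j, mu j * P.ineq j x = 0 := le_antisymm (Finset.sum_nonpos hle) h
    intro j
    exact (Finset.sum_eq_zero_iff_of_nonpos hle).1 hsum j (Finset.mem_univ j)
  have hFJ : P.IsFritzJohn x m₀ mu lam := by
    refine ⟨fun v hv => ?_, hcompl, hm₀, hmu, hx⟩
    have hd : HasFDerivAt (fun v => m₀ * φ (v - x) + ∑ j, mu j * P.ineq j v
        + ∑ l, lam l * P.eqc l v) (m₀ • φ + ∑ j, mu j • fderiv ℝ (P.ineq j) x
        + ∑ l, lam l • fderiv ℝ (P.eqc l) x) x := by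
      refine HasFDerivAt.add (HasFDerivAt.add ?_ ?_) ?_
      · have : HasFDerivAt (fun v => φ (v - x)) φ x := by
          exact φ.hasFDerivAt.comp x ((hasFDerivAt_id x).sub_const x)
        exact this.const_mul m₀
      · exact HasFDerivAt.fun_sum fun j _ => (hdiff j).hasFDerivAt.const_mul (mu j)
      · refine HasFDerivAt.fun_sum fun l _ => HasFDerivAt.const_mul ?_ (lam l)
        have : P.eqc l = fun v => L l (v - x) := funext (hLx l)
        rw [this]
        have : DifferentiableAt ℝ (fun v => L l (v - x)) x := by fun_prop
        exact this.hasFDerivAt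
    -- By complementarity the Lagrangian vanishes at `x`, and `hlag` makes it nonnegative on the
    -- domain. So `x` minimises it there, and the first-order condition is the stationarity
    -- inequality.
    have h := hdom.fderiv_nonneg_of_isMinOn hx.1 hv (f := fun v => m₀ * φ (v - x)
      + ∑ j, mu j * P.ineq j v + ∑ l, lam l * P.eqc l v) (fun w hw => by
        simpa [hcompl, hx.2.2] using hlag w hw) hd.differentiableAt
    rwa [hd.fderiv] at h
  have hw : (m₀, mu, lam) ≠ 0 := by
    intro hzero
    obtain ⟨h1, h2, h3⟩ : m₀ = 0 ∧ mu = 0 ∧ lam = 0 := by simpa using hzero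
    refine hf (ContinuousLinearMap.ext fun ⟨r, s, t⟩ => ?_)
    rw [hfw, h1, h2, h3]
    simp
  refine ⟨‖(m₀, mu, lam)‖⁻¹ • (m₀, mu, lam), ?_, hFJ.smul (inv_nonneg.2 (norm_nonneg _))⟩
  rw [norm_smul, norm_inv, norm_norm, inv_mul_cancel₀ (norm_ne_zero_iff.2 hw)]

end NLP

/-! ### Continuity and chain-rule tools. -/

section Helpers

theorem ContinuousOn.tendsto_comp_of_mem {α β ι : Type*} [TopologicalSpace α] [TopologicalSpace β]
    {f : α → β} {s : Set α} (hf : ContinuousOn f s) {l : Filter ι} {x : ι → α} {a : α}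
    (ha : a ∈ s) (hx : Tendsto x l (𝓝 a)) (hs : ∀ n, x n ∈ s) :
    Tendsto (fun n => f (x n)) l (𝓝 (f a)) :=
  (hf a ha).tendsto.comp (tendsto_nhdsWithin_iff.2 ⟨hx, Eventually.of_forall hs⟩)

variable {E F G : Type*} [NormedAddCommGroup E] [NormedSpace ℝ E] [NormedAddCommGroup F]
  [NormedSpace ℝ F] [NormedAddCommGroup G] [NormedSpace ℝ G]

theorem DifferentiableAt.hasFDerivAt_comp_apply {r : ℕ} {g : F → Fin r → ℝ} {A : E → F}
    {A' : E →L[ℝ] F} {x : E} (hg : DifferentiableAt ℝ g (A x)) (hA : HasFDerivAt A A' x)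
    (j : Fin r) :
    HasFDerivAt (fun u => g (A u) j)
      (((ContinuousLinearMap.proj (R := ℝ) (φ := fun _ : Fin r => ℝ) j).comp
        (fderiv ℝ g (A x))).comp A') x :=
  (((ContinuousLinearMap.proj (R := ℝ) (φ := fun _ : Fin r => ℝ) j).hasFDerivAt).comp (A x)
    hg.hasFDerivAt).comp x hA

theorem Filter.Tendsto.clm_comp_right {ι : Type*} {l : Filter ι} {D : ι → F →L[ℝ] G}
    {D₀ : F →L[ℝ] G} (h : Tendsto D l (𝓝 D₀)) (A : E →L[ℝ] F) :
    Tendsto (fun n => (D n).comp A) l (𝓝 (D₀.comp A)) :=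
  ((continuous_id.clm_comp continuous_const).tendsto D₀).comp h

theorem Filter.Tendsto.clm_comp_left {ι : Type*} {l : Filter ι} {D : ι → E →L[ℝ] F}
    {D₀ : E →L[ℝ] F} (h : Tendsto D l (𝓝 D₀)) (B : F →L[ℝ] G) :
    Tendsto (fun n => B.comp (D n)) l (𝓝 (B.comp D₀)) :=
  ((continuous_const.clm_comp continuous_id).tendsto D₀).comp h

end Helpers

theorem IsObjectiveSurrogate.differentiableAt {E : Type} [NormedAddCommGroup E] [NormedSpace ℝ E]
    {U X : Set E} {f : E → ℝ} {F : E → E → ℝ} (h : IsObjectiveSurrogate U X f F)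
    (hU : IsOpen U) {x z : E} (hx : x ∈ U) (hz : z ∈ X) :
    DifferentiableAt ℝ (fun u => F u z) x :=
  ((h.contDiff z hz).differentiableOn one_ne_zero).differentiableAt (hU.mem_nhds hx)

theorem NLP.isClosed_feasibleSet {E J M : Type} [TopologicalSpace E] {P : NLP E J M}
    (hdom : IsClosed P.dom) (hineq : ∀ j, ContinuousOn (P.ineq j) P.dom)
    (heqc : ∀ l, ContinuousOn (P.eqc l) P.dom) : IsClosed P.feasibleSet := by
  have h : P.feasibleSet = P.dom ∩ ((⋂ j, P.dom ∩ P.ineq j ⁻¹' Iic 0) ∩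
      ⋂ l, P.dom ∩ P.eqc l ⁻¹' {0}) := by
    ext x
    simp only [NLP.feasibleSet, mem_ofPred_eq, mem_inter_iff, mem_iInter, mem_preimage,
      mem_Iic, mem_singleton_iff]
    exact ⟨fun ⟨h1, h2, h3⟩ => ⟨h1, fun j => ⟨h1, h2 j⟩, fun l => ⟨h1, h3 l⟩⟩,
      fun ⟨h1, h2, h3⟩ => ⟨h1, fun j => (h2 j).2, fun l => (h3 l).2⟩⟩
  rw [h]
  exact hdom.inter ((isClosed_iInter fun j =>
    (hineq j).preimage_isClosed_of_isClosed hdom isClosed_Iic).inter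
    (isClosed_iInter fun l => (heqc l).preimage_isClosed_of_isClosed hdom isClosed_singleton))

/-! ### Block structure of the problem and its derivatives. -/

namespace SPDProblem

variable (P : SPDProblem)

/-- The projection `(x, y) ↦ (x i, y)`. -/
noncomputable def pair (i : Fin P.I) : P.Var →L[ℝ] Vec (P.n i) × Vec P.n₀ :=
  ((ContinuousLinearMap.proj i).comp (ContinuousLinearMap.fst ℝ _ _)).prod
    (ContinuousLinearMap.snd ℝ _ _)

@[simp] theorem pair_apply (i : Fin P.I) (q : P.Var) : P.pair i q = (q.1 i, q.2) := rfl

/-- The problem in the variable `(x, y)` with the same constraint structure as `P.toNLP` but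
other functions. -/
noncomputable def blockNLP (f₀ : Vec P.n₀ → ℝ) (f : ∀ i, Vec (P.n i) × Vec P.n₀ → ℝ)
    (gt : ∀ i, Vec (P.n i) × Vec P.n₀ → Fin (P.rt i) → ℝ)
    (g : ∀ i, Vec (P.n i) → Fin (P.r i) → ℝ) (g₀ : Vec P.n₀ → Fin P.r₀ → ℝ) :
    NLP P.Var P.J P.M where
  obj := fun p => f₀ p.2 + ∑ i, f i (p.1 i, p.2)
  ineq := Sum.elim (fun a p => gt a.1 (p.1 a.1, p.2) a.2)
    (Sum.elim (fun a p => g a.1 (p.1 a.1) a.2) (fun j p => g₀ p.2 j))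
  eqc := fun a p => P.eqFun a.1 (p.1 a.1) p.2 a.2
  dom := P.domain

/-- The original and the approximate problem are both instances of `blockNLP`, so one computation of
derivatives serves both. -/
theorem toNLP_eq_blockNLP : P.toNLP = P.blockNLP P.f₀ P.f P.gt P.g P.g₀ := rfl

theorem approx_eq_blockNLP {P : SPDProblem} (S : P.Surrogates) (p : P.Var) :
    S.approx p = P.blockNLP (fun y => S.F₀ y p.2) (fun i u => S.F i u (p.1 i, p.2))
      (fun i u => S.Gt i u (p.1 i, p.2)) (fun i u => S.G i u (p.1 i))
      (fun y => S.G₀ y p.2) := rfl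

/-- The linear part of the equality constraints of block `i` in `x i`. -/
noncomputable def eqX (i : Fin P.I) (l : Fin (P.m i)) : Vec (P.n i) →L[ℝ] ℝ :=
  LinearMap.toContinuousLinearMap ((LinearMap.proj l).comp ((P.Ax i).mulVecLin.comp
    (WithLp.linearEquiv 2 ℝ (Fin (P.n i) → ℝ)).toLinearMap))

/-- The linear part of the equality constraints of block `i` in `y`. -/
noncomputable def eqY (i : Fin P.I) (l : Fin (P.m i)) : Vec P.n₀ →L[ℝ] ℝ :=
  LinearMap.toContinuousLinearMap ((LinearMap.proj l).comp ((P.Ay i).mulVecLin.comp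
    (WithLp.linearEquiv 2 ℝ (Fin P.n₀ → ℝ)).toLinearMap))

theorem eqY_apply (i : Fin P.I) (l : Fin (P.m i)) (v : Vec P.n₀) :
    P.eqY i l v = (P.Ay i *ᵥ v.ofLp) l := rfl

theorem eqFun_apply (i : Fin P.I) (l : Fin (P.m i)) (u : Vec (P.n i)) (y : Vec P.n₀) :
    P.eqFun i u y l = P.eqX i l u + P.eqY i l y + P.b i l := rfl

/-- The linear part of the equality constraints. -/
noncomputable def eqLin (a : P.M) : P.Var →L[ℝ] ℝ :=
  ((P.eqX a.1 a.2).coprod (P.eqY a.1 a.2)).comp (P.pair a.1)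

theorem eqFun_sub (a : P.M) (u v : P.Var) :
    P.eqFun a.1 (u.1 a.1) u.2 a.2 - P.eqFun a.1 (v.1 a.1) v.2 a.2 = P.eqLin a (u - v) := by
  simp only [eqFun_apply, eqLin, ContinuousLinearMap.comp_apply, map_sub, pair_apply,
    ContinuousLinearMap.coprod_apply]
  ring

theorem hasFDerivAt_eqFun (a : P.M) (q : P.Var) :
    HasFDerivAt (fun p : P.Var => P.eqFun a.1 (p.1 a.1) p.2 a.2) (P.eqLin a) q := by
  have h : (fun p : P.Var => P.eqFun a.1 (p.1 a.1) p.2 a.2) =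
      fun p => P.eqLin a p + P.b a.1 a.2 := by
    funext p
    simp [eqFun_apply, eqLin]
  rw [h]
  exact (P.eqLin a).hasFDerivAt.add_const _

section Block

variable {P} {f₀ : Vec P.n₀ → ℝ} {f : ∀ i, Vec (P.n i) × Vec P.n₀ → ℝ}
  {gt : ∀ i, Vec (P.n i) × Vec P.n₀ → Fin (P.rt i) → ℝ}
  {g : ∀ i, Vec (P.n i) → Fin (P.r i) → ℝ} {g₀ : Vec P.n₀ → Fin P.r₀ → ℝ} {q : P.Var}

theorem hasFDerivAt_blockNLP_obj (h₀ : DifferentiableAt ℝ f₀ q.2)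
    (h : ∀ i, DifferentiableAt ℝ (f i) (q.1 i, q.2)) :
    HasFDerivAt (P.blockNLP f₀ f gt g g₀).obj
      ((fderiv ℝ f₀ q.2).comp (ContinuousLinearMap.snd ℝ _ _)
        + ∑ i, (fderiv ℝ (f i) (q.1 i, q.2)).comp (P.pair i)) q := by
  refine HasFDerivAt.add (h₀.hasFDerivAt.comp q hasFDerivAt_snd)
    (HasFDerivAt.fun_sum fun i _ => ?_)
  exact (h i).hasFDerivAt.comp q (P.pair i).hasFDerivAt

theorem fderiv_blockNLP_obj_apply (h₀ : DifferentiableAt ℝ f₀ q.2)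
    (h : ∀ i, DifferentiableAt ℝ (f i) (q.1 i, q.2)) (d : P.Var) :
    fderiv ℝ (P.blockNLP f₀ f gt g g₀).obj q d =
      fderiv ℝ f₀ q.2 d.2 + ∑ i, fderiv ℝ (f i) (q.1 i, q.2) (d.1 i, d.2) := by
  rw [(hasFDerivAt_blockNLP_obj h₀ h).fderiv]
  simp

theorem hasFDerivAt_blockNLP_ineq_inl (a : Σ i, Fin (P.rt i))
    (h : DifferentiableAt ℝ (gt a.1) (q.1 a.1, q.2)) :
    HasFDerivAt ((P.blockNLP f₀ f gt g g₀).ineq (Sum.inl a))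
      (((ContinuousLinearMap.proj (R := ℝ) (φ := fun _ : Fin (P.rt a.1) => ℝ) a.2).comp
        (fderiv ℝ (gt a.1) (q.1 a.1, q.2))).comp (P.pair a.1)) q :=
  DifferentiableAt.hasFDerivAt_comp_apply (A := P.pair a.1) h (P.pair a.1).hasFDerivAt a.2

theorem hasFDerivAt_blockNLP_ineq_inr_inl (a : Σ i, Fin (P.r i))
    (h : DifferentiableAt ℝ (g a.1) (q.1 a.1)) :
    HasFDerivAt ((P.blockNLP f₀ f gt g g₀).ineq (Sum.inr (Sum.inl a)))
      (((ContinuousLinearMap.proj (R := ℝ) (φ := fun _ : Fin (P.r a.1) => ℝ) a.2).comp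
        (fderiv ℝ (g a.1) (q.1 a.1))).comp
        ((ContinuousLinearMap.fst ℝ _ _).comp (P.pair a.1))) q :=
  DifferentiableAt.hasFDerivAt_comp_apply
    (A := (ContinuousLinearMap.fst ℝ _ _).comp (P.pair a.1)) h
    (ContinuousLinearMap.hasFDerivAt _) a.2

theorem hasFDerivAt_blockNLP_ineq_inr_inr (j : Fin P.r₀) (h : DifferentiableAt ℝ g₀ q.2) :
    HasFDerivAt ((P.blockNLP f₀ f gt g g₀).ineq (Sum.inr (Sum.inr j)))
      (((ContinuousLinearMap.proj (R := ℝ) (φ := fun _ : Fin P.r₀ => ℝ) j).comp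
        (fderiv ℝ g₀ q.2)).comp (ContinuousLinearMap.snd ℝ _ _)) q :=
  DifferentiableAt.hasFDerivAt_comp_apply (A := ContinuousLinearMap.snd ℝ _ _) h
    (ContinuousLinearMap.hasFDerivAt _) j

theorem differentiableAt_blockNLP_ineq (ht : ∀ i, DifferentiableAt ℝ (gt i) (q.1 i, q.2))
    (hg : ∀ i, DifferentiableAt ℝ (g i) (q.1 i)) (h₀ : DifferentiableAt ℝ g₀ q.2) :
    ∀ j, DifferentiableAt ℝ ((P.blockNLP f₀ f gt g g₀).ineq j) q := by
  rintro (a | a | j)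
  · exact (hasFDerivAt_blockNLP_ineq_inl a (ht a.1)).differentiableAt
  · exact (hasFDerivAt_blockNLP_ineq_inr_inl a (hg a.1)).differentiableAt
  · exact (hasFDerivAt_blockNLP_ineq_inr_inr j h₀).differentiableAt

end Block

namespace Assumptions

variable {P}

theorem isOpen_prod (hP : P.Assumptions) (i : Fin P.I) : IsOpen (P.U i ×ˢ P.V) :=
  (hP.U_open i).prod hP.V_open

theorem prod_subset (hP : P.Assumptions) (i : Fin P.I) : P.X i ×ˢ P.Y ⊆ P.U i ×ˢ P.V :=
  prod_mono (hP.X_sub_U i) hP.Y_sub_V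

end Assumptions
end SPDProblem

theorem IsConstraintSurrogate.differentiableAt_apply {E : Type} [NormedAddCommGroup E]
    [NormedSpace ℝ E] {r : ℕ} {X : Set E} {g : E → Fin r → ℝ} {G : E → E → Fin r → ℝ}
    (h : IsConstraintSurrogate X g G) {x z : E} (hx : x ∈ X) (hz : z ∈ X) (j : Fin r) :
    DifferentiableAt ℝ (fun u => G u z j) x :=
  differentiableAt_pi.1 (h.diff x hx z hz) j

namespace SPDProblem

variable {P : SPDProblem}

theorem Assumptions.convex_domain (hP : P.Assumptions) : Convex ℝ P.domain := by
  intro u hu v hv a b ha hb hab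
  exact ⟨fun i => hP.X_convex i (hu.1 i) (hv.1 i) ha hb hab, hP.Y_convex hu.2 hv.2 ha hb hab⟩

theorem Assumptions.isClosed_domain (hP : P.Assumptions) : IsClosed P.domain := by
  have h : P.domain = (⋂ i, (fun p : P.Var => p.1 i) ⁻¹' P.X i) ∩ Prod.snd ⁻¹' P.Y := by
    ext p
    simp [domain]
  rw [h]
  refine IsClosed.inter (isClosed_iInter fun i => ?_) (hP.Y_closed.preimage continuous_snd)
  exact (hP.X_closed i).preimage (by fun_prop)

theorem continuous_eqFun (a : P.M) :
    Continuous (fun p : P.Var => P.eqFun a.1 (p.1 a.1) p.2 a.2) :=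
  continuous_iff_continuousAt.2 fun q => (P.hasFDerivAt_eqFun a q).continuousAt

section Original

theorem Assumptions.differentiableAt_f (hP : P.Assumptions) {q : P.Var} (hq : q ∈ P.domain)
    (i : Fin P.I) : DifferentiableAt ℝ (P.f i) (q.1 i, q.2) :=
  ((hP.f_contDiff i).differentiableOn one_ne_zero).differentiableAt
    ((hP.isOpen_prod i).mem_nhds (hP.prod_subset i ⟨hq.1 i, hq.2⟩))

theorem Assumptions.differentiableAt_f₀ (hP : P.Assumptions) {y : Vec P.n₀} (hy : y ∈ P.Y) :
    DifferentiableAt ℝ P.f₀ y :=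
  (hP.f₀_contDiff.differentiableOn one_ne_zero).differentiableAt
    (hP.V_open.mem_nhds (hP.Y_sub_V hy))

theorem Assumptions.differentiableAt_gt (hP : P.Assumptions) {q : P.Var} (hq : q ∈ P.domain)
    (i : Fin P.I) : DifferentiableAt ℝ (P.gt i) (q.1 i, q.2) :=
  ((hP.gt_contDiff i).differentiableOn one_ne_zero).differentiableAt
    ((hP.isOpen_prod i).mem_nhds (hP.prod_subset i ⟨hq.1 i, hq.2⟩))

theorem Assumptions.differentiableAt_g (hP : P.Assumptions) {q : P.Var} (hq : q ∈ P.domain)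
    (i : Fin P.I) : DifferentiableAt ℝ (P.g i) (q.1 i) :=
  ((hP.g_contDiff i).differentiableOn one_ne_zero).differentiableAt
    ((hP.U_open i).mem_nhds (hP.X_sub_U i (hq.1 i)))

theorem Assumptions.differentiableAt_g₀ (hP : P.Assumptions) {y : Vec P.n₀} (hy : y ∈ P.Y) :
    DifferentiableAt ℝ P.g₀ y :=
  (hP.g₀_contDiff.differentiableOn one_ne_zero).differentiableAt
    (hP.V_open.mem_nhds (hP.Y_sub_V hy))

theorem Assumptions.isClosed_feasibleSet (hP : P.Assumptions) :
    IsClosed P.toNLP.feasibleSet := by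
  refine NLP.isClosed_feasibleSet hP.isClosed_domain (fun j q hq => ?_)
    fun l => (continuous_eqFun l).continuousOn
  exact (differentiableAt_blockNLP_ineq (hP.differentiableAt_gt hq) (hP.differentiableAt_g hq)
    (hP.differentiableAt_g₀ hq.2) j).continuousAt.continuousWithinAt

/-- The descent lemma for the objective function. -/
theorem Assumptions.exists_descent (hP : P.Assumptions) : ∃ K : ℝ, 0 ≤ K ∧
    ∀ u ∈ P.domain, ∀ v ∈ P.domain, P.toNLP.obj u ≤
      P.toNLP.obj v + fderiv ℝ P.toNLP.obj v (u - v) + K * ‖u - v‖ ^ 2 := by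
  obtain ⟨K₀, hK₀⟩ := hP.f₀_lip
  choose K hK using hP.f_lip
  refine ⟨(K₀ : ℝ) + ∑ i, (K i : ℝ), by positivity, fun u hu v hv => ?_⟩
  rw [toNLP_eq_blockNLP, fderiv_blockNLP_obj_apply (hP.differentiableAt_f₀ hv.2)
    (hP.differentiableAt_f hv)]
  have h₀ := hP.Y_convex.descent_of_lipschitzOnWith_fderiv
    (fun y hy => hP.differentiableAt_f₀ hy) hK₀ hu.2 hv.2
  have h₀' : (K₀ : ℝ) * ‖u.2 - v.2‖ ^ 2 ≤ K₀ * ‖u - v‖ ^ 2 := by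
    gcongr
    exact norm_snd_le (u - v)
  have h : ∀ i ∈ Finset.univ, P.f i (u.1 i, u.2) ≤ P.f i (v.1 i, v.2)
      + fderiv ℝ (P.f i) (v.1 i, v.2) ((u - v).1 i, (u - v).2) + K i * ‖u - v‖ ^ 2 := by
    intro i _
    have h := ((hP.X_convex i).prod hP.Y_convex).descent_of_lipschitzOnWith_fderiv
      (fun x hx => ((hP.f_contDiff i).differentiableOn one_ne_zero).differentiableAt
        ((hP.isOpen_prod i).mem_nhds (hP.prod_subset i hx))) (hK i)
      (u := (u.1 i, u.2)) (v := (v.1 i, v.2)) ⟨hu.1 i, hu.2⟩ ⟨hv.1 i, hv.2⟩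
    refine h.trans (add_le_add le_rfl ?_)
    gcongr
    refine max_le ?_ (norm_snd_le (u - v))
    exact (norm_le_pi_norm (u - v).1 i).trans (norm_fst_le (u - v))
  have hsum := Finset.sum_le_sum h
  simp only [Finset.sum_add_distrib, ← Finset.sum_mul] at hsum
  simp only [blockNLP]
  simp only [Prod.snd_sub] at *
  linarith

end Original

/-! ### The approximate problem: consistency, convexity and its optimal point. -/

namespace Surrogates

variable {S : P.Surrogates} {p q : P.Var}

theorem IsValid.differentiableAt_F₀ (hS : S.IsValid) (hP : P.Assumptions) {y z : Vec P.n₀}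
    (hy : y ∈ P.Y) (hz : z ∈ P.Y) : DifferentiableAt ℝ (fun u => S.F₀ u z) y :=
  hS.F₀.differentiableAt hP.V_open (hP.Y_sub_V hy) hz

theorem IsValid.differentiableAt_F (hS : S.IsValid) (hP : P.Assumptions) (hp : p ∈ P.domain)
    (hq : q ∈ P.domain) (i : Fin P.I) :
    DifferentiableAt ℝ (fun u => S.F i u (p.1 i, p.2)) (q.1 i, q.2) :=
  (hS.F i).differentiableAt (hP.isOpen_prod i) (hP.prod_subset i ⟨hq.1 i, hq.2⟩)
    ⟨hp.1 i, hp.2⟩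

theorem IsValid.fderiv_obj_apply (hS : S.IsValid) (hP : P.Assumptions) (hp : p ∈ P.domain)
    (hq : q ∈ P.domain) (d : P.Var) : fderiv ℝ (S.approx p).obj q d =
      fderiv ℝ (fun y => S.F₀ y p.2) q.2 d.2
        + ∑ i, fderiv ℝ (fun u => S.F i u (p.1 i, p.2)) (q.1 i, q.2) (d.1 i, d.2) := by
  rw [approx_eq_blockNLP, fderiv_blockNLP_obj_apply (hS.differentiableAt_F₀ hP hq.2 hp.2)
    (hS.differentiableAt_F hP hp hq)]

theorem IsValid.differentiableAt_obj (hS : S.IsValid) (hP : P.Assumptions) (hp : p ∈ P.domain)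
    (hq : q ∈ P.domain) : DifferentiableAt ℝ (S.approx p).obj q := by
  rw [approx_eq_blockNLP]
  exact (hasFDerivAt_blockNLP_obj (hS.differentiableAt_F₀ hP hq.2 hp.2)
    (hS.differentiableAt_F hP hp hq)).differentiableAt

theorem IsValid.differentiableAt_ineq (hS : S.IsValid) (hp : p ∈ P.domain)
    (hq : q ∈ P.domain) (j : P.J) : DifferentiableAt ℝ ((S.approx p).ineq j) q := by
  rw [approx_eq_blockNLP]
  exact differentiableAt_blockNLP_ineq
    (fun i => (hS.Gt i).diff _ ⟨hq.1 i, hq.2⟩ (p.1 i, p.2) ⟨hp.1 i, hp.2⟩)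
    (fun i => (hS.G i).diff _ (hq.1 i) _ (hp.1 i))
    (hS.G₀.diff _ hq.2 _ hp.2) j

theorem IsValid.fderiv_obj_eq (hS : S.IsValid) (hP : P.Assumptions) (hp : p ∈ P.domain) :
    fderiv ℝ (S.approx p).obj p = fderiv ℝ P.toNLP.obj p := by
  refine ContinuousLinearMap.ext fun d => ?_
  rw [hS.fderiv_obj_apply hP hp hp, toNLP_eq_blockNLP, fderiv_blockNLP_obj_apply
    (hP.differentiableAt_f₀ hp.2) (hP.differentiableAt_f hp), hS.F₀.grad_eq _ hp.2]
  congr 1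
  exact Finset.sum_congr rfl fun i _ => by rw [(hS.F i).grad_eq _ ⟨hp.1 i, hp.2⟩]

theorem IsValid.convexOn_ineq (hS : S.IsValid) (hP : P.Assumptions) (hp : p ∈ P.domain)
    (j : P.J) : ConvexOn ℝ P.domain ((S.approx p).ineq j) := by
  rcases j with a | a | j
  · refine ((((hS.Gt a.1).convex (p.1 a.1, p.2) ⟨hp.1 _, hp.2⟩ a.2).comp_linearMap
      (P.pair a.1).toLinearMap)).subset (fun q hq => ?_) hP.convex_domain
    exact ⟨hq.1 _, hq.2⟩
  · refine ((((hS.G a.1).convex (p.1 a.1) (hp.1 _) a.2).comp_linearMap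
      ((ContinuousLinearMap.fst ℝ _ _).comp (P.pair a.1)).toLinearMap)).subset
      (fun q hq => ?_) hP.convex_domain
    exact hq.1 _
  · refine ((hS.G₀.convex p.2 hp.2 j).comp_linearMap
      (ContinuousLinearMap.snd ℝ _ _).toLinearMap).subset (fun q hq => ?_) hP.convex_domain
    exact hq.2

theorem IsValid.convex_feasibleSet (hS : S.IsValid) (hP : P.Assumptions) (hp : p ∈ P.domain) :
    Convex ℝ (S.approx p).feasibleSet := by
  intro u hu v hv a b ha hb hab
  refine ⟨hP.convex_domain hu.1 hv.1 ha hb hab, fun j => ?_, fun l => ?_⟩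
  · have h := (hS.convexOn_ineq hP hp j).2 hu.1 hv.1 ha hb hab
    have h1 := mul_nonpos_of_nonneg_of_nonpos ha (hu.2.1 j)
    have h2 := mul_nonpos_of_nonneg_of_nonpos hb (hv.2.1 j)
    simp only [smul_eq_mul] at h
    linarith
  · have h1 := P.eqFun_sub l (a • u + b • v) u
    have h2 := P.eqFun_sub l v u
    have hu' : P.eqFun l.1 (u.1 l.1) u.2 l.2 = 0 := hu.2.2 l
    have hv' : P.eqFun l.1 (v.1 l.1) v.2 l.2 = 0 := hv.2.2 l
    have h3 : a • u + b • v - u = b • (v - u) := by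
      rw [← eq_sub_iff_add_eq] at hab
      rw [hab]
      module
    rw [h3, map_smul, ← h2, hu', hv', sub_zero, sub_zero, smul_zero] at h1
    exact h1

theorem IsValid.isClosed_feasibleSet (hS : S.IsValid) (hP : P.Assumptions)
    (hp : p ∈ P.domain) : IsClosed (S.approx p).feasibleSet :=
  NLP.isClosed_feasibleSet hP.isClosed_domain
    (fun j _ hq => (hS.differentiableAt_ineq hp hq j).continuousAt.continuousWithinAt)
    fun l => (continuous_eqFun l).continuousOn

theorem IsValid.ineq_self (hS : S.IsValid) (hp : p ∈ P.domain) (j : P.J) :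
    (S.approx p).ineq j p = P.toNLP.ineq j p := by
  rcases j with a | a | j
  · exact congrFun ((hS.Gt a.1).val_eq (p.1 a.1, p.2) ⟨hp.1 _, hp.2⟩) a.2
  · exact congrFun ((hS.G a.1).val_eq _ (hp.1 _)) a.2
  · exact congrFun (hS.G₀.val_eq _ hp.2) j

theorem IsValid.ineq_le (hS : S.IsValid) (hp : p ∈ P.domain) (hq : q ∈ P.domain) (j : P.J) :
    P.toNLP.ineq j q ≤ (S.approx p).ineq j q := by
  rcases j with a | a | j
  · exact (hS.Gt a.1).upper (q.1 a.1, q.2) ⟨hq.1 _, hq.2⟩ (p.1 a.1, p.2) ⟨hp.1 _, hp.2⟩ a.2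
  · exact (hS.G a.1).upper _ (hq.1 _) _ (hp.1 _) a.2
  · exact hS.G₀.upper _ hq.2 _ hp.2 j

theorem IsValid.self_mem_feasibleSet (hS : S.IsValid) (hp : p ∈ P.toNLP.feasibleSet) :
    p ∈ (S.approx p).feasibleSet :=
  ⟨hp.1, fun j => (hS.ineq_self hp.1 j).trans_le (hp.2.1 j), hp.2.2⟩

/-- The approximate constraints majorise the true ones; this keeps the outer iterates feasible. -/
theorem IsValid.feasibleSet_subset (hS : S.IsValid) (hp : p ∈ P.domain) :
    (S.approx p).feasibleSet ⊆ P.toNLP.feasibleSet := fun _ hq =>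
  ⟨hq.1, fun j => (hS.ineq_le hp hq.1 j).trans (hq.2.1 j), hq.2.2⟩

/-- The approximate objective functions are uniformly strongly convex. -/
theorem IsValid.exists_strong (hS : S.IsValid) (hP : P.Assumptions) :
    ∃ c : ℝ, 0 < c ∧ ∀ p ∈ P.domain, ∀ u ∈ P.domain, ∀ v ∈ P.domain,
      (S.approx p).obj v + fderiv ℝ (S.approx p).obj v (u - v) + c * ‖u - v‖ ^ 2 ≤
        (S.approx p).obj u := by
  obtain ⟨c₀, hc₀, h₀⟩ := hS.F₀.strong
  choose c hc h using fun i => (hS.F i).strong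
  -- The halves come from `Convex.quadratic_lower_bound`. Choosing `m` small in `𝓝[>] 0` avoids a
  -- minimum over a possibly empty index set.
  obtain ⟨m, hm, hm₀, hmi⟩ : ∃ m : ℝ, 0 < m ∧ m ≤ c₀ / 2 ∧ ∀ i, m ≤ c i / 2 := by
    have h1 : ∀ᶠ m : ℝ in 𝓝[>] 0, m ≤ c₀ / 2 :=
      mem_nhdsWithin_of_mem_nhds (Iic_mem_nhds (half_pos hc₀))
    have h2 : ∀ᶠ m : ℝ in 𝓝[>] 0, ∀ i, m ≤ c i / 2 :=
      eventually_all.2 fun i => mem_nhdsWithin_of_mem_nhds (Iic_mem_nhds (half_pos (hc i)))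
    obtain ⟨m, hm, hm1, hm2⟩ := ((eventually_mem_nhdsWithin (a := (0 : ℝ))).and (h1.and h2)).exists
    exact ⟨m, hm, hm1, hm2⟩
  refine ⟨m, hm, fun p hp u hu v hv => ?_⟩
  rw [hS.fderiv_obj_apply hP hp hv]
  have H₀ := hP.Y_convex.quadratic_lower_bound (fun y hy => hS.differentiableAt_F₀ hP hy hp.2)
    (fun x hx v hv => h₀ x hx v hv p.2 hp.2) hu.2 hv.2
  have H : ∀ i, S.F i (v.1 i, v.2) (p.1 i, p.2)
      + fderiv ℝ (fun u => S.F i u (p.1 i, p.2)) (v.1 i, v.2) ((u - v).1 i, (u - v).2)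
      + m * ‖((u - v).1 i, (u - v).2)‖ ^ 2 ≤ S.F i (u.1 i, u.2) (p.1 i, p.2) := by
    intro i
    have H := ((hP.X_convex i).prod hP.Y_convex).quadratic_lower_bound
      (f := fun u => S.F i u (p.1 i, p.2)) (c := c i)
      (fun y hy => (hS.F i).differentiableAt (hP.isOpen_prod i) (hP.prod_subset i hy)
        ⟨hp.1 i, hp.2⟩)
      (fun x hx v hv => h i x hx v hv (p.1 i, p.2) ⟨hp.1 i, hp.2⟩)
      (u := (u.1 i, u.2)) (v := (v.1 i, v.2)) ⟨hu.1 i, hu.2⟩ ⟨hv.1 i, hv.2⟩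
    refine le_trans (add_le_add le_rfl ?_) H
    exact mul_le_mul_of_nonneg_right (hmi i) (sq_nonneg _)
  have hsum := Finset.sum_le_sum fun i (_ : i ∈ Finset.univ) => H i
  simp only [Finset.sum_add_distrib, ← Finset.mul_sum] at hsum
  have hy : m * ‖(u - v).2‖ ^ 2 ≤ c₀ / 2 * ‖u.2 - v.2‖ ^ 2 :=
    mul_le_mul_of_nonneg_right hm₀ (sq_nonneg _)
  -- The joint norm is a maximum, hence its square is at most the sum of squares. The separate `y`
  -- term, due to `F₀`, is what covers the case of no blocks.
  have hnorm : ‖u - v‖ ^ 2 ≤ ‖(u - v).2‖ ^ 2 + ∑ i, ‖((u - v).1 i, (u - v).2)‖ ^ 2 := by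
    have hnn : 0 ≤ ∑ i, ‖((u - v).1 i, (u - v).2)‖ ^ 2 :=
      Finset.sum_nonneg fun i _ => sq_nonneg _
    rcases le_total ‖(u - v).1‖ ‖(u - v).2‖ with hle | hle
    · rw [Prod.norm_def, max_eq_right hle]
      linarith
    · rw [Prod.norm_def, max_eq_left hle]
      have h1 : ‖(u - v).1‖ ≤ √(∑ i, ‖((u - v).1 i, (u - v).2)‖ ^ 2) := by
        refine (pi_norm_le_iff_of_nonneg (Real.sqrt_nonneg _)).2 fun i => ?_
        refine (norm_fst_le ((u - v).1 i, (u - v).2)).trans (Real.le_sqrt_of_sq_le ?_)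
        exact Finset.single_le_sum (f := fun i => ‖((u - v).1 i, (u - v).2)‖ ^ 2)
          (fun i _ => sq_nonneg _) (Finset.mem_univ i)
      have h2 := (Real.le_sqrt (norm_nonneg _) hnn).1 h1
      have := sq_nonneg ‖(u - v).2‖
      linarith
  have hnorm' := mul_le_mul_of_nonneg_left hnorm hm.le
  simp only [approx, Prod.snd_sub] at *
  linarith

theorem IsValid.fderiv_nonneg_of_isOptimal (hS : S.IsValid) (hP : P.Assumptions)
    (hp : p ∈ P.domain) (hq : (S.approx p).IsOptimal q) :
    ∀ v ∈ (S.approx p).feasibleSet, 0 ≤ fderiv ℝ (S.approx p).obj q (v - q) := fun _ hv =>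
  (hS.convex_feasibleSet hP hp).fderiv_nonneg_of_isMinOn hq.1 hv hq.2
    (hS.differentiableAt_obj hP hp hq.1.1)

/-- Existence by coercivity: beyond radius `D / c` around `p` the quadratic term outweighs the slope
`D` at `p`, so minimising over a compact ball suffices. Uniqueness is strong convexity at the
minimiser. -/
theorem IsValid.exists_isUniqueOptimal (hS : S.IsValid) (hP : P.Assumptions)
    (hp : p ∈ P.toNLP.feasibleSet) : ∃ q, (S.approx p).IsUniqueOptimal q := by
  obtain ⟨c, hc, hstrong⟩ := hS.exists_strong hP
  have hpf := hS.self_mem_feasibleSet hp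
  set D := ‖fderiv ℝ (S.approx p).obj p‖ with hD
  set A := (S.approx p).feasibleSet ∩ Metric.closedBall p (D / c) with hA
  have hcomp : IsCompact A :=
    (isCompact_closedBall p (D / c)).inter_left (hS.isClosed_feasibleSet hP hp.1)
  have hpA : p ∈ A := ⟨hpf, Metric.mem_closedBall_self (div_nonneg (norm_nonneg _) hc.le)⟩
  obtain ⟨q, hqA, hmin⟩ := hcomp.exists_isMinOn ⟨p, hpA⟩ (f := (S.approx p).obj)
    fun x hx => (hS.differentiableAt_obj hP hp.1 hx.1.1).continuousAt.continuousWithinAt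
  have hopt : (S.approx p).IsOptimal q := by
    refine ⟨hqA.1, fun v hv => ?_⟩
    by_cases hvA : v ∈ A
    · exact hmin hvA
    have hfar : D / c < ‖v - p‖ := by
      rw [← dist_eq_norm]
      exact not_le.1 fun h => hvA ⟨hv, h⟩
    have h1 := hstrong p hp.1 v hv.1 p hp.1
    have h2 : -(D * ‖v - p‖) ≤ fderiv ℝ (S.approx p).obj p (v - p) :=
      neg_le_of_abs_le ((fderiv ℝ (S.approx p).obj p).le_opNorm (v - p))
    have h3 : D * ‖v - p‖ ≤ c * ‖v - p‖ ^ 2 := by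
      rw [div_lt_iff₀ hc] at hfar
      nlinarith [norm_nonneg (v - p)]
    have h4 : (S.approx p).obj q ≤ (S.approx p).obj p := hmin hpA
    linarith
  refine ⟨q, hopt, fun v hv => ?_⟩
  have h1 := hstrong p hp.1 v hv.1.1 q hopt.1.1
  have h2 := hS.fderiv_nonneg_of_isOptimal hP hp.1 hopt v hv.1
  have h3 := hv.2 q hopt.1
  have h4 : c * ‖v - q‖ ^ 2 ≤ 0 := by linarith
  have h5 : ‖v - q‖ ^ 2 = 0 :=
    le_antisymm (nonpos_of_mul_nonpos_right h4 hc) (sq_nonneg _)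
  exact sub_eq_zero.1 (norm_eq_zero.1 (pow_eq_zero_iff two_ne_zero |>.1 h5))

theorem IsValid.exists_isFritzJohn (hS : S.IsValid) (hP : P.Assumptions) (hp : p ∈ P.domain)
    (hq : (S.approx p).IsOptimal q) : ∃ w : ℝ × (P.J → ℝ) × (P.M → ℝ), ‖w‖ = 1 ∧
      (S.approx p).IsFritzJohn q w.1 w.2.1 w.2.2 :=
  NLP.exists_isFritzJohn (L := P.eqLin) hP.convex_domain (hS.convexOn_ineq hP hp)
    (hS.differentiableAt_ineq hp hq.1.1) (fun l u v => P.eqFun_sub l u v) hq.1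
    (hS.fderiv_nonneg_of_isOptimal hP hp hq)

end Surrogates
end SPDProblem

/-! ### Euclidean projections, gradients and inner products. -/

/-- The projection onto a convex set moves closer to every point of the set. -/
theorem Convex.norm_sub_le_of_forall_dist_le {H : Type*} [NormedAddCommGroup H]
    [InnerProductSpace ℝ H] {C : Set H} (hC : Convex ℝ C) {w y c : H} (hy : y ∈ C)
    (hmin : ∀ z ∈ C, dist y w ≤ dist z w) (hc : c ∈ C) : ‖y - c‖ ^ 2 ≤ ‖w - c‖ ^ 2 := by
  have : Nonempty C := ⟨⟨y, hy⟩⟩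
  have hinf : ‖w - y‖ = ⨅ z : C, ‖w - z‖ := by
    refine le_antisymm (le_ciInf fun z => ?_)
      (ciInf_le ⟨0, by rintro _ ⟨z, rfl⟩; exact norm_nonneg _⟩ (⟨y, hy⟩ : C))
    have := hmin z z.2
    rwa [dist_comm, dist_comm (z : H), dist_eq_norm, dist_eq_norm] at this
  have h := (norm_eq_iInf_iff_real_inner_le_zero hC hy).1 hinf c hc
  have h1 : w - c = (w - y) - (c - y) := by abel
  rw [norm_sub_rev y c, h1, norm_sub_sq_real (w - y)]
  linarith [sq_nonneg ‖w - y‖]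

theorem tendsto_zero_of_sq {a : ℕ → ℝ} (ha : ∀ t, 0 ≤ a t)
    (h : Tendsto (fun t => a t ^ 2) atTop (𝓝 0)) : Tendsto a atTop (𝓝 0) := by
  have := (Real.continuous_sqrt.tendsto 0).comp h
  rw [Real.sqrt_zero] at this
  exact this.congr fun t => Real.sqrt_sq (ha t)

theorem inner_gradient_eq_fderiv {H : Type*} [NormedAddCommGroup H] [InnerProductSpace ℝ H]
    [CompleteSpace H] (f : H → ℝ) (x d : H) : inner ℝ (gradient f x) d = fderiv ℝ f x d := by
  rw [← toDual_gradient, InnerProductSpace.toDual_apply_apply]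

theorem norm_gradient_eq_norm_fderiv {H : Type*} [NormedAddCommGroup H] [InnerProductSpace ℝ H]
    [CompleteSpace H] (f : H → ℝ) (x : H) : ‖gradient f x‖ = ‖fderiv ℝ f x‖ := by
  rw [← toDual_gradient, LinearIsometryEquiv.norm_map]

theorem inner_toLp_transpose_mulVec {m n : ℕ} (A : Matrix (Fin m) (Fin n) ℝ) (u : Fin m → ℝ)
    (d : EuclideanSpace ℝ (Fin n)) :
    inner ℝ (WithLp.toLp 2 (Aᵀ *ᵥ u)) d = ∑ j, u j * (A *ᵥ d.ofLp) j := by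
  rw [EuclideanSpace.inner_eq_star_dotProduct]
  simp only [star_trivial]
  rw [dotProduct_comm, Matrix.mulVec_transpose, ← Matrix.dotProduct_mulVec]
  rfl

/-! ### Primal decomposition: splitting into master problem and subproblems. -/

namespace SPDProblem

variable {P : SPDProblem} {S : P.Surrogates} {p q : P.Var}

namespace Surrogates

theorem mem_feasibleSet_approx_iff : q ∈ (S.approx p).feasibleSet ↔
    q.2 ∈ S.masterSet p ∧ ∀ i, q.1 i ∈ (S.sub p i q.2).feasibleSet := by
  constructor
  · rintro ⟨h1, h2, h3⟩
    refine ⟨⟨h1.2, fun j => h2 (Sum.inr (Sum.inr j))⟩, fun i => ⟨h1.1 i, ?_, fun l => h3 ⟨i, l⟩⟩⟩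
    rintro (j | j)
    · exact h2 (Sum.inl ⟨i, j⟩)
    · exact h2 (Sum.inr (Sum.inl ⟨i, j⟩))
  · rintro ⟨h1, h2⟩
    refine ⟨⟨fun i => (h2 i).1, h1.1⟩, ?_, fun a => (h2 a.1).2.2 a.2⟩
    rintro (a | a | j)
    · exact (h2 a.1).2.1 (Sum.inl a.2)
    · exact (h2 a.1).2.1 (Sum.inr a.2)
    · exact h1.2 j

theorem IsValid.convex_masterSet (hS : S.IsValid) (hP : P.Assumptions) (hp : p ∈ P.domain) :
    Convex ℝ (S.masterSet p) := by
  intro u hu v hv a b ha hb hab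
  refine ⟨hP.Y_convex hu.1 hv.1 ha hb hab, fun j => ?_⟩
  have h := (hS.G₀.convex p.2 hp.2 j).2 hu.1 hv.1 ha hb hab
  have h1 := mul_nonpos_of_nonneg_of_nonpos ha (hu.2 j)
  have h2 := mul_nonpos_of_nonneg_of_nonpos hb (hv.2 j)
  simp only [smul_eq_mul] at h
  linarith

section Derivatives

variable {i : Fin P.I} {xi : Vec (P.n i)} {y : Vec P.n₀}

theorem IsValid.fderiv_sub_obj (hS : S.IsValid) (hP : P.Assumptions) (hp : p ∈ P.domain)
    (hx : xi ∈ P.X i) (hy : y ∈ P.Y) : fderiv ℝ (S.sub p i y).obj xi =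
      (fderiv ℝ (fun u => S.F i u (p.1 i, p.2)) (xi, y)).comp (ContinuousLinearMap.inl ℝ _ _) := by
  have hF : DifferentiableAt ℝ (fun u => S.F i u (p.1 i, p.2)) (xi, y) :=
    (hS.F i).differentiableAt (hP.isOpen_prod i) (hP.prod_subset i ⟨hx, hy⟩) ⟨hp.1 i, hp.2⟩
  exact (hF.hasFDerivAt.comp (f := fun e => (e, y)) xi (hasFDerivAt_prodMk_left xi y)).fderiv

theorem IsValid.fderiv_sub_ineq_inl (hS : S.IsValid) (hp : p ∈ P.domain)
    (hx : xi ∈ P.X i) (hy : y ∈ P.Y) (j : Fin (P.rt i)) :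
    fderiv ℝ ((S.sub p i y).ineq (Sum.inl j)) xi =
      ((ContinuousLinearMap.proj (R := ℝ) (φ := fun _ : Fin (P.rt i) => ℝ) j).comp
        (fderiv ℝ (fun u => S.Gt i u (p.1 i, p.2)) (xi, y))).comp
        (ContinuousLinearMap.inl ℝ _ _) :=
  (((hS.Gt i).diff (xi, y) ⟨hx, hy⟩ (p.1 i, p.2) ⟨hp.1 i, hp.2⟩).hasFDerivAt_comp_apply
    (A := fun e => (e, y)) (x := xi) (hasFDerivAt_prodMk_left xi y) j).fderiv

theorem IsValid.fderiv_sub_ineq_inr (hS : S.IsValid) (hp : p ∈ P.domain)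
    (hx : xi ∈ P.X i) (j : Fin (P.r i)) :
    fderiv ℝ ((S.sub p i y).ineq (Sum.inr j)) xi =
      ((ContinuousLinearMap.proj (R := ℝ) (φ := fun _ : Fin (P.r i) => ℝ) j).comp
        (fderiv ℝ (fun u => S.G i u (p.1 i)) xi)).comp (ContinuousLinearMap.id ℝ _) :=
  (((hS.G i).diff xi hx (p.1 i) (hp.1 i)).hasFDerivAt_comp_apply (A := id)
    (hasFDerivAt_id xi) j).fderiv

theorem fderiv_sub_eqc (l : Fin (P.m i)) :
    fderiv ℝ ((S.sub p i y).eqc l) xi = P.eqX i l := by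
  have h : (S.sub p i y).eqc l = fun x => P.eqX i l x + (P.eqY i l y + P.b i l) := by
    funext x
    rw [← add_assoc]
    rfl
  rw [h]
  exact ((P.eqX i l).hasFDerivAt.add_const _).fderiv

/-- Near `y`, which is interior to `V`, the functions `Fy i` and `F i (xi, ·)` differ by a constant.
-/
theorem ObjectiveSeparable.fderiv_Fy (hF : S.ObjectiveSeparable) (hS : S.IsValid)
    (hP : P.Assumptions) (hp : p ∈ P.domain) (hx : xi ∈ P.X i) (hy : y ∈ P.Y) :
    fderiv ℝ (fun y => S.Fy i y (p.1 i, p.2)) y =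
      (fderiv ℝ (fun u => S.F i u (p.1 i, p.2)) (xi, y)).comp (ContinuousLinearMap.inr ℝ _ _) := by
  have hFd : DifferentiableAt ℝ (fun u => S.F i u (p.1 i, p.2)) (xi, y) :=
    (hS.F i).differentiableAt (hP.isOpen_prod i) (hP.prod_subset i ⟨hx, hy⟩) ⟨hp.1 i, hp.2⟩
  have h1 := hFd.hasFDerivAt.comp y (hasFDerivAt_prodMk_right xi y)
  have h2 : (fun y => S.Fy i y (p.1 i, p.2)) =ᶠ[𝓝 y]
      fun y => ((fun u => S.F i u (p.1 i, p.2)) ∘ fun y => (xi, y)) y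
        - S.Fx i xi (p.1 i, p.2) := by
    filter_upwards [hP.V_open.mem_nhds (hP.Y_sub_V hy)] with y' hy'
    simp [hF.split i xi (hP.X_sub_U i hx) y' hy' (p.1 i, p.2) ⟨hp.1 i, hp.2⟩]
  exact ((h1.sub_const _).congr_of_eventuallyEq h2).fderiv

theorem ConstraintSeparable.fderiv_Gt_inr (hG : S.ConstraintSeparable) (hS : S.IsValid)
    (hP : P.Assumptions) (hp : p ∈ P.domain) (hx : xi ∈ P.X i) (hy : y ∈ P.Y) (d : Vec P.n₀) :
    fderiv ℝ (fun u => S.Gt i u (p.1 i, p.2)) (xi, y) (0, d) =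
      S.C i (p.1 i, p.2) *ᵥ d.ofLp := by
  have h1 := ((hS.Gt i).diff (xi, y) ⟨hx, hy⟩ (p.1 i, p.2) ⟨hp.1 i, hp.2⟩).hasFDerivAt.comp y
    (hasFDerivAt_prodMk_right xi y)
  let A : Vec P.n₀ →L[ℝ] (Fin (P.rt i) → ℝ) := LinearMap.toContinuousLinearMap
    ((S.C i (p.1 i, p.2)).mulVecLin.comp (WithLp.linearEquiv 2 ℝ (Fin P.n₀ → ℝ)).toLinearMap)
  have h2 : ((fun u => S.Gt i u (p.1 i, p.2)) ∘ fun y => (xi, y)) =ᶠ[𝓝 y]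
      fun y => S.Gx i xi (p.1 i, p.2) + A y := by
    filter_upwards [hP.V_open.mem_nhds (hP.Y_sub_V hy)] with y' hy'
    exact hG.split i xi (hP.X_sub_U i hx) y' hy' (p.1 i, p.2) ⟨hp.1 i, hp.2⟩
  have h3 := (A.hasFDerivAt.const_add (S.Gx i xi (p.1 i, p.2))).congr_of_eventuallyEq h2
  have h4 := DFunLike.congr_fun (h1.unique h3) d
  exact h4

end Derivatives

end Surrogates

/-! ### Convergence of the inner loop. -/

namespace InnerTrace

open Surrogates

variable {T : P.InnerTrace}

theorem IsRun.primal_mem (hT : T.IsRun S p) (hS : S.IsValid) (hp : p ∈ P.toNLP.feasibleSet)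
    (t : ℕ) : T.primal t ∈ (S.approx p).feasibleSet := by
  refine mem_feasibleSet_approx_iff.2 ⟨?_, fun i => (hT.x_opt t i).1⟩
  rcases t with _ | t
  · have := (mem_feasibleSet_approx_iff.1 (hS.self_mem_feasibleSet hp)).1
    rwa [← hT.init] at this
  · exact hT.y_mem t

/-- The vectors computed by the inner loop are subgradients, up to first order terms, of the
optimal value of the subproblems as a function of the coupling variable. -/
theorem IsRun.inner_subgrad_le (hT : T.IsRun S p) (hP : P.Assumptions) (hS : S.IsValid)
    (hF : S.ObjectiveSeparable) (hG : S.ConstraintSeparable) (hp : p ∈ P.toNLP.feasibleSet)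
    (hq : q ∈ (S.approx p).feasibleSet) (t : ℕ) :
    inner ℝ (T.subgrad S p t) (q.2 - T.y t) ≤
      fderiv ℝ (S.approx p).obj (T.primal t) (q - T.primal t) := by
  have hpd := hp.1
  have hz := hT.primal_mem hS hp t
  have hxt : ∀ i, T.x t i ∈ P.X i := hz.1.1
  have hyt : T.y t ∈ P.Y := hz.1.2
  rw [hS.fderiv_obj_apply hP hpd hz.1, subgrad, inner_add_left, sum_inner]
  refine add_le_add (inner_gradient_eq_fderiv _ _ _).le (Finset.sum_le_sum fun i _ => ?_)
  set z := (p.1 i, p.2)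
  set dx := q.1 i - T.x t i with hdx
  set dy := q.2 - T.y t with hdy
  change _ ≤ fderiv ℝ (fun u => S.F i u z) (T.x t i, T.y t) (dx, dy)
  have hsplit : ((dx, dy) : Vec (P.n i) × Vec P.n₀) = (dx, 0) + (0, dy) := by simp
  rw [inner_add_left, inner_add_left, inner_gradient_eq_fderiv, inner_toLp_transpose_mulVec,
    inner_toLp_transpose_mulVec, hF.fderiv_Fy hS hP hpd (hxt i) hyt, hsplit, map_add]
  change fderiv ℝ (fun u => S.F i u z) (T.x t i, T.y t) (0, dy) + _ + _ ≤ _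
  have hK := hT.multipliers t i
  -- The subproblem's stationarity bounds the `x`-part of the derivative from below; the three
  -- estimates that follow convert its multiplier terms into the `dy` terms of the subgradient.
  have hst := hK.1 (q.1 i) (hq.1.1 i)
  simp only [Fintype.sum_sum_type, hS.fderiv_sub_obj hP hpd (hxt i) hyt,
    hS.fderiv_sub_ineq_inl hpd (hxt i) hyt, hS.fderiv_sub_ineq_inr hpd (hxt i),
    fderiv_sub_eqc, add_apply, sum_apply, smul_apply, smul_eq_mul,
    ContinuousLinearMap.comp_apply, ContinuousLinearMap.inl_apply, ContinuousLinearMap.proj_apply,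
    ContinuousLinearMap.id_apply, ← hdx] at hst
  -- Joint convexity bounds `mu` times the linearised constraint at `q` by `mu * Gt(q) ≤ 0`; the
  -- constant term drops by complementarity. The `y`-part of the linearisation is `C dy`.
  have hcoup : ∀ j ∈ Finset.univ, T.mu t i (Sum.inl j) *
      fderiv ℝ (fun u => S.Gt i u z) (T.x t i, T.y t) (dx, 0) j ≤
      -(T.mu t i (Sum.inl j) * (S.C i z *ᵥ dy.ofLp) j) := by
    intro j _
    have hmu := hK.2.2.1 (Sum.inl j)
    have hcompl : T.mu t i (Sum.inl j) * S.Gt i (T.x t i, T.y t) z j = 0 := hK.2.1 (Sum.inl j)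
    have hle : S.Gt i (q.1 i, q.2) z j ≤ 0 := hq.2.1 (Sum.inl ⟨i, j⟩)
    have hconv := ((hS.Gt i).convex z ⟨hpd.1 i, hpd.2⟩ j).fderiv_le_sub
      (u := (q.1 i, q.2)) (v := (T.x t i, T.y t)) ⟨hq.1.1 i, hq.1.2⟩ ⟨hxt i, hyt⟩
      ((hS.Gt i).differentiableAt_apply ⟨hxt i, hyt⟩ ⟨hpd.1 i, hpd.2⟩ j)
    have hcomp := (((hS.Gt i).diff (T.x t i, T.y t) ⟨hxt i, hyt⟩ z
      ⟨hpd.1 i, hpd.2⟩).hasFDerivAt_comp_apply (A := id) (hasFDerivAt_id _) j).fderiv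
    simp only [id_eq] at hcomp
    rw [hcomp] at hconv
    have hd : ((q.1 i, q.2) : Vec (P.n i) × Vec P.n₀) - (T.x t i, T.y t) =
      (dx, 0) + (0, dy) := by simp [hdx, hdy]
    rw [hd, map_add] at hconv
    simp only [ContinuousLinearMap.comp_apply, ContinuousLinearMap.id_apply,
      ContinuousLinearMap.proj_apply] at hconv
    rw [hG.fderiv_Gt_inr hS hP hpd (hxt i) hyt] at hconv
    have h := mul_le_mul_of_nonneg_left (hconv.trans hle) hmu
    rw [mul_add, mul_add, hcompl, mul_zero] at h
    linarith
  have hloc : ∀ j ∈ Finset.univ, T.mu t i (Sum.inr j) *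
      fderiv ℝ (fun u => S.G i u (p.1 i)) (T.x t i) dx j ≤ 0 := by
    intro j _
    have hmu := hK.2.2.1 (Sum.inr j)
    have hcompl : T.mu t i (Sum.inr j) * S.G i (T.x t i) (p.1 i) j = 0 := hK.2.1 (Sum.inr j)
    have hle : S.G i (q.1 i) (p.1 i) j ≤ 0 := hq.2.1 (Sum.inr (Sum.inl ⟨i, j⟩))
    have hconv := ((hS.G i).convex (p.1 i) (hpd.1 i) j).fderiv_le_sub (hq.1.1 i) (hxt i)
      ((hS.G i).differentiableAt_apply (hxt i) (hpd.1 i) j)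
    have hcomp := (((hS.G i).diff (T.x t i) (hxt i) (p.1 i)
      (hpd.1 i)).hasFDerivAt_comp_apply (A := id) (hasFDerivAt_id _) j).fderiv
    simp only [id_eq] at hcomp
    rw [hcomp] at hconv
    simp only [ContinuousLinearMap.comp_apply, ContinuousLinearMap.id_apply,
      ContinuousLinearMap.proj_apply] at hconv
    have h := mul_le_mul_of_nonneg_left (hconv.trans hle) hmu
    rw [mul_add, hcompl, mul_zero] at h
    linarith
  have heq : ∀ l ∈ Finset.univ, T.lam t i l * P.eqX i l dx =
      -(T.lam t i l * (P.Ay i *ᵥ dy.ofLp) l) := by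
    intro l _
    have h1 : P.eqFun i (q.1 i) q.2 l = 0 := hq.2.2 ⟨i, l⟩
    have h2 : P.eqFun i (T.x t i) (T.y t) l = 0 := hz.2.2 ⟨i, l⟩
    rw [eqFun_apply] at h1 h2
    have h3 : P.eqX i l dx = -P.eqY i l dy := by
      rw [hdx, hdy, map_sub, map_sub]
      linarith
    rw [h3, eqY_apply]
    ring
  have h1 := Finset.sum_le_sum hcoup
  have h2 := Finset.sum_nonpos hloc
  have h3 := Finset.sum_congr rfl heq
  rw [Finset.sum_neg_distrib] at h1 h3
  linarith

/-- Unbounded multipliers would blow up along a subsequence of iterates converging to a point `q`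
feasible for the approximate problem. All subproblems are feasible at `q.2`, so the regularity
hypothesis applies there and excludes this. -/
theorem IsRun.exists_multiplier_bound (hT : T.IsRun S p) (hP : P.Assumptions) (hS : S.IsValid)
    (hp : p ∈ P.toNLP.feasibleSet)
    (hreg : ∀ i, ∀ y ∈ S.masterSet p ∩ S.masterDom p, (S.sub p i y).AllRegular)
    (hbdd : Bornology.IsBounded (range T.primal)) (i : Fin P.I) :
    ∃ B, ∀ t, ‖(T.mu t i, T.lam t i)‖ ≤ B := by
  by_contra hcon
  push Not at hcon
  choose s hs using fun n : ℕ => hcon n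
  obtain ⟨q, -, φ, hφ, hlim⟩ := tendsto_subseq_of_bounded hbdd
    (x := fun n => T.primal (s n)) fun n => ⟨_, rfl⟩
  have hpd := hp.1
  have hmem := fun n => hT.primal_mem hS hp (s (φ n))
  have hq : q ∈ (S.approx p).feasibleSet :=
    (hS.isClosed_feasibleSet hP hpd).mem_of_tendsto hlim (Eventually.of_forall hmem)
  have hq' := mem_feasibleSet_approx_iff.1 hq
  have hlim2 : Tendsto (fun n => (T.x (s (φ n)) i, T.y (s (φ n)))) atTop (𝓝 (q.1 i, q.2)) :=
    ((P.pair i).continuous.tendsto q).comp hlim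
  have hlim1 : Tendsto (fun n => T.x (s (φ n)) i) atTop (𝓝 (q.1 i)) :=
    (continuous_fst.tendsto _).comp hlim2
  have hxy : ∀ n, (T.x (s (φ n)) i, T.y (s (φ n))) ∈ P.X i ×ˢ P.Y :=
    fun n => ⟨(hmem n).1.1 i, (hmem n).1.2⟩
  have hqxy : (q.1 i, q.2) ∈ P.X i ×ˢ P.Y := ⟨hq.1.1 i, hq.1.2⟩
  have hz : (p.1 i, p.2) ∈ P.X i ×ˢ P.Y := ⟨hpd.1 i, hpd.2⟩
  have hconv : NLP.ConvergesTo (fun n => S.sub p i (T.y (s (φ n)))) (fun n => T.x (s (φ n)) i)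
      (S.sub p i q.2) (q.1 i) := by
    refine ⟨fun _ => rfl, hq'.2 i, hlim1, ?_, ?_, ?_, fun l => ?_⟩
    · simp only [hS.fderiv_sub_obj hP hpd hqxy.1 hqxy.2,
        fun n => hS.fderiv_sub_obj hP hpd (hxy n).1 (hxy n).2]
      refine Tendsto.clm_comp_right ?_ _
      exact (hS.F i).grad_cont.tendsto_comp_of_mem (a := ((q.1 i, q.2), (p.1 i, p.2)))
        ⟨hP.prod_subset i hqxy, hz⟩ (hlim2.prodMk_nhds tendsto_const_nhds)
        fun n => ⟨hP.prod_subset i (hxy n), hz⟩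
    · rintro (j | j)
      · refine ((continuous_apply j).tendsto _).comp ((hS.Gt i).cont.tendsto_comp_of_mem
          (a := ((q.1 i, q.2), (p.1 i, p.2))) ⟨hqxy, hz⟩
          (hlim2.prodMk_nhds tendsto_const_nhds) fun n => ⟨hxy n, hz⟩)
      · refine ((continuous_apply j).tendsto _).comp ((hS.G i).cont.tendsto_comp_of_mem
          (a := (q.1 i, p.1 i)) ⟨hqxy.1, hz.1⟩
          (hlim1.prodMk_nhds tendsto_const_nhds) fun n => ⟨(hxy n).1, hz.1⟩)
    · rintro (j | j)
      · simp only [hS.fderiv_sub_ineq_inl hpd hqxy.1 hqxy.2,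
          fun n => hS.fderiv_sub_ineq_inl hpd (hxy n).1 (hxy n).2]
        refine Tendsto.clm_comp_right (Tendsto.clm_comp_left ?_ _) _
        exact (hS.Gt i).grad_cont.tendsto_comp_of_mem
          (a := ((q.1 i, q.2), (p.1 i, p.2))) ⟨hqxy, hz⟩
          (hlim2.prodMk_nhds tendsto_const_nhds) fun n => ⟨hxy n, hz⟩
      · rw [hS.fderiv_sub_ineq_inr hpd hqxy.1]
        simp only [fun n => hS.fderiv_sub_ineq_inr (y := T.y (s (φ n))) hpd (hxy n).1 j]
        refine Tendsto.clm_comp_right (Tendsto.clm_comp_left ?_ _) _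
        exact (hS.G i).grad_cont.tendsto_comp_of_mem
          (a := (q.1 i, p.1 i)) ⟨hqxy.1, hz.1⟩
          (hlim1.prodMk_nhds tendsto_const_nhds) fun n => ⟨(hxy n).1, hz.1⟩
    · simp only [fderiv_sub_eqc]
      exact tendsto_const_nhds
  refine hconv.not_tendsto_atTop
    (hreg i q.2 ⟨hq'.1, hP.Y_sub_V hqxy.2, fun i => ⟨_, hq'.2 i⟩⟩ _ (hq'.2 i))
    (fun n => hT.multipliers (s (φ n)) i) ?_
  refine tendsto_atTop_mono (fun n => (hs (φ n)).le) ?_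
  exact tendsto_natCast_atTop_atTop.comp hφ.tendsto_atTop

theorem IsRun.exists_subgrad_bound (hT : T.IsRun S p) (hP : P.Assumptions) (hS : S.IsValid)
    (hF : S.ObjectiveSeparable) (hp : p ∈ P.toNLP.feasibleSet)
    (hreg : ∀ i, ∀ y ∈ S.masterSet p ∩ S.masterDom p, (S.sub p i y).AllRegular)
    (hbdd : Bornology.IsBounded (range T.primal)) : ∃ B, ∀ t, ‖T.subgrad S p t‖ ≤ B := by
  have hpd := hp.1
  have hK : IsCompact (closure (range T.primal)) := hbdd.isCompact_closure
  have hKmem : closure (range T.primal) ⊆ (S.approx p).feasibleSet := by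
    refine closure_minimal ?_ (hS.isClosed_feasibleSet hP hpd)
    rintro _ ⟨t, rfl⟩
    -- The closure stays in the feasible set, hence in the domain, where the surrogate gradients are
    -- continuous and so bounded on it.
    exact hT.primal_mem hS hp t
  have hin : ∀ t, T.primal t ∈ closure (range T.primal) := fun t => subset_closure ⟨t, rfl⟩
  obtain ⟨B₀, hB₀⟩ := hK.exists_bound_of_continuousOn
    (f := fun q : P.Var => fderiv ℝ (fun y => S.F₀ y p.2) q.2)
    (hS.F₀.grad_cont.comp (f := fun q : P.Var => (q.2, p.2)) (by fun_prop)
      fun q hq => ⟨hP.Y_sub_V (hKmem hq).1.2, hpd.2⟩)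
  choose B hB using fun i : Fin P.I => hK.exists_bound_of_continuousOn
    (f := fun q : P.Var => (fderiv ℝ (fun u => S.F i u (p.1 i, p.2)) (q.1 i, q.2)).comp
      (ContinuousLinearMap.inr ℝ _ _))
    (((hS.F i).grad_cont.comp (f := fun q : P.Var => ((q.1 i, q.2), (p.1 i, p.2))) (by fun_prop)
      fun q hq => ⟨hP.prod_subset i ⟨(hKmem hq).1.1 i, (hKmem hq).1.2⟩, hpd.1 i, hpd.2⟩).clm_comp
      continuousOn_const)
  choose R hR using hT.exists_multiplier_bound hP hS hp hreg hbdd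
  choose D hD using fun i : Fin P.I =>
    (isCompact_closedBall (0 : (Fin (P.rt i) ⊕ Fin (P.r i) → ℝ) × (Fin (P.m i) → ℝ))
      (R i)).exists_bound_of_continuousOn
    (f := fun w => (WithLp.toLp 2 ((S.C i (p.1 i, p.2))ᵀ *ᵥ fun j => w.1 (Sum.inl j))
      + WithLp.toLp 2 ((P.Ay i)ᵀ *ᵥ w.2) : Vec P.n₀)) (by
        refine Continuous.continuousOn (Continuous.add ?_ ?_)
        · exact (PiLp.continuous_toLp 2 _).comp (Continuous.matrix_mulVec continuous_const
            (by fun_prop))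
        · exact (PiLp.continuous_toLp 2 _).comp (Continuous.matrix_mulVec continuous_const
            (by fun_prop)))
  refine ⟨B₀ + ∑ i, (B i + D i), fun t => ?_⟩
  refine (norm_add_le _ _).trans (add_le_add ?_ ((norm_sum_le _ _).trans
    (Finset.sum_le_sum fun i _ => ?_)))
  · rw [norm_gradient_eq_norm_fderiv]
    exact hB₀ _ (hin t)
  · rw [add_assoc]
    refine (norm_add_le _ _).trans (add_le_add ?_ ?_)
    · have hz := (hKmem (hin t)).1
      rw [norm_gradient_eq_norm_fderiv, hF.fderiv_Fy (y := T.y t) hS hP hpd (hz.1 i) hz.2]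
      exact hB i _ (hin t)
    · exact hD i (T.mu t i, T.lam t i) (by simpa using hR i t)

/-- Convergence of the inner loop. -/
theorem IsRun.tendsto_isUniqueOptimal (hT : T.IsRun S p) (hP : P.Assumptions) (hS : S.IsValid)
    (hF : S.ObjectiveSeparable) (hG : S.ConstraintSeparable) (hp : p ∈ P.toNLP.feasibleSet)
    (hreg : ∀ i, ∀ y ∈ S.masterSet p ∩ S.masterDom p, (S.sub p i y).AllRegular)
    (hbdd : Bornology.IsBounded (range T.primal)) :
    ∃ q, (S.approx p).IsUniqueOptimal q ∧ Tendsto T.primal atTop (𝓝 q) := by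
  have hpd := hp.1
  obtain ⟨q, hq⟩ := hS.exists_isUniqueOptimal hP hp
  refine ⟨q, hq, ?_⟩
  have hqf := hq.1.1
  obtain ⟨c, hc, hstrong⟩ := hS.exists_strong hP
  obtain ⟨B, hB⟩ := hT.exists_subgrad_bound hP hS hF hp hreg hbdd
  have hmem := fun t => hT.primal_mem hS hp t
  -- Adding the strong convexity inequalities at `q` and at the iterate doubles `c`; the derivative
  -- at `q` has a favourable sign by optimality.
  have hkey : ∀ t, 2 * c * ‖T.primal t - q‖ ^ 2 ≤
      inner ℝ (T.subgrad S p t) (T.y t - q.2) := by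
    intro t
    have h1 := hstrong p hpd q hqf.1 (T.primal t) (hmem t).1
    have h2 := hstrong p hpd (T.primal t) (hmem t).1 q hqf.1
    have h3 := hS.fderiv_nonneg_of_isOptimal hP hpd hq.1 _ (hmem t)
    have h4 := hT.inner_subgrad_le hP hS hF hG hp hqf t
    rw [← neg_sub (T.y t), inner_neg_right] at h4
    rw [norm_sub_rev q] at h1
    linarith
  have hyle : ∀ t, ‖T.y t - q.2‖ ≤ ‖T.primal t - q‖ := fun t => norm_snd_le (T.primal t - q)
  have hstep : ∀ t, ‖T.y (t + 1) - q.2‖ ^ 2 ≤ ‖T.y t - q.2‖ ^ 2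
      - 4 * c * T.step t * ‖T.y t - q.2‖ ^ 2 + T.step t ^ 2 * B ^ 2 := by
    intro t
    have h1 := (hS.convex_masterSet hP hpd).norm_sub_le_of_forall_dist_le (hT.y_mem t)
      (hT.y_proj t) (mem_feasibleSet_approx_iff.1 hqf).1
    have h2 : T.y t - T.step t • T.subgrad S p t - q.2 =
      (T.y t - q.2) - T.step t • T.subgrad S p t := by abel
    rw [h2, norm_sub_sq_real (T.y t - q.2), inner_smul_right, real_inner_comm, norm_smul, mul_pow,
      Real.norm_of_nonneg (hT.step_pos t).le] at h1
    have h3 : T.step t ^ 2 * ‖T.subgrad S p t‖ ^ 2 ≤ T.step t ^ 2 * B ^ 2 := by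
      gcongr
      exact hB t
    have h4 : T.step t * (2 * c * ‖T.y t - q.2‖ ^ 2) ≤
        T.step t * inner ℝ (T.subgrad S p t) (T.y t - q.2) := by
      refine mul_le_mul_of_nonneg_left (le_trans ?_ (hkey t)) (hT.step_pos t).le
      gcongr
      exact hyle t
    linarith
  have hy : Tendsto (fun t => ‖T.y t - q.2‖ ^ 2) atTop (𝓝 0) :=
    tendsto_zero_of_perturbed_contraction (κ := 4 * c) (by positivity) (sq_nonneg B)
      (fun t => sq_nonneg _) hT.step_pos hT.step_sum hT.step_sq hstep
  have hy' : Tendsto (fun t => ‖T.y t - q.2‖) atTop (𝓝 0) := by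
    exact tendsto_zero_of_sq (fun t => norm_nonneg _) hy
  -- Now `hkey` is read in the other direction: with `‖s‖ ≤ B` it bounds the full error, including
  -- the `x`-part, by the error in `y`.
  have hsq : Tendsto (fun t => ‖T.primal t - q‖ ^ 2) atTop (𝓝 0) := by
    have hlim : Tendsto (fun t => B * ‖T.y t - q.2‖ / (2 * c)) atTop (𝓝 0) := by
      simpa using (hy'.const_mul B).div_const (2 * c)
    refine squeeze_zero (fun t => sq_nonneg _) (fun t => ?_) hlim
    rw [le_div_iff₀ (by positivity), mul_comm]
    refine (hkey t).trans ((real_inner_le_norm _ _).trans ?_)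
    gcongr
    exact hB t
  rw [tendsto_iff_norm_sub_tendsto_zero]
  exact tendsto_zero_of_sq (fun t => norm_nonneg _) hsq

end InnerTrace
end SPDProblem

/-! ### Convergence of the outer loop. -/

namespace SPDProblem

variable {P : SPDProblem} {S : P.Surrogates}

section Derivatives

variable {p q : P.Var}

theorem Surrogates.IsValid.fderiv_obj (hS : S.IsValid) (hP : P.Assumptions) (hp : p ∈ P.domain)
    (hq : q ∈ P.domain) : fderiv ℝ (S.approx p).obj q =
      (fderiv ℝ (fun y => S.F₀ y p.2) q.2).comp (ContinuousLinearMap.snd ℝ _ _) +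
        ∑ i, (fderiv ℝ (fun u => S.F i u (p.1 i, p.2)) (q.1 i, q.2)).comp (P.pair i) := by
  rw [approx_eq_blockNLP, (hasFDerivAt_blockNLP_obj (hS.differentiableAt_F₀ hP hq.2 hp.2)
    (hS.differentiableAt_F hP hp hq)).fderiv]

theorem Surrogates.IsValid.fderiv_ineq_inl (hS : S.IsValid) (hp : p ∈ P.domain)
    (hq : q ∈ P.domain) (b : Σ i, Fin (P.rt i)) :
    fderiv ℝ ((S.approx p).ineq (Sum.inl b)) q =
      ((ContinuousLinearMap.proj (R := ℝ) (φ := fun _ : Fin (P.rt b.1) => ℝ) b.2).comp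
        (fderiv ℝ (fun u => S.Gt b.1 u (p.1 b.1, p.2)) (q.1 b.1, q.2))).comp (P.pair b.1) := by
  rw [approx_eq_blockNLP]
  exact (hasFDerivAt_blockNLP_ineq_inl (gt := fun i u => S.Gt i u (p.1 i, p.2)) b
    ((hS.Gt b.1).diff _ ⟨hq.1 _, hq.2⟩ _ ⟨hp.1 _, hp.2⟩)).fderiv

theorem Surrogates.IsValid.fderiv_ineq_inr_inl (hS : S.IsValid) (hp : p ∈ P.domain)
    (hq : q ∈ P.domain) (b : Σ i, Fin (P.r i)) :
    fderiv ℝ ((S.approx p).ineq (Sum.inr (Sum.inl b))) q =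
      ((ContinuousLinearMap.proj (R := ℝ) (φ := fun _ : Fin (P.r b.1) => ℝ) b.2).comp
        (fderiv ℝ (fun u => S.G b.1 u (p.1 b.1)) (q.1 b.1))).comp
        ((ContinuousLinearMap.fst ℝ _ _).comp (P.pair b.1)) := by
  rw [approx_eq_blockNLP]
  exact (hasFDerivAt_blockNLP_ineq_inr_inl (g := fun i u => S.G i u (p.1 i)) b
    ((hS.G b.1).diff _ (hq.1 _) _ (hp.1 _))).fderiv

theorem Surrogates.IsValid.fderiv_ineq_inr_inr (hS : S.IsValid) (hp : p ∈ P.domain)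
    (hq : q ∈ P.domain) (j : Fin P.r₀) :
    fderiv ℝ ((S.approx p).ineq (Sum.inr (Sum.inr j))) q =
      ((ContinuousLinearMap.proj (R := ℝ) (φ := fun _ : Fin P.r₀ => ℝ) j).comp
        (fderiv ℝ (fun y => S.G₀ y p.2) q.2)).comp (ContinuousLinearMap.snd ℝ _ _) := by
  rw [approx_eq_blockNLP]
  exact (hasFDerivAt_blockNLP_ineq_inr_inr j (hS.G₀.diff _ hq.2 _ hp.2)).fderiv

end Derivatives

/-- If base points and iterates approach the same feasible point, then the approximate problems
converge to the original one to first order. -/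
theorem Surrogates.IsValid.convergesTo (hS : S.IsValid) (hP : P.Assumptions)
    {p q : ℕ → P.Var} {a : P.Var} (ha : a ∈ P.toNLP.feasibleSet) (hp : ∀ n, p n ∈ P.domain)
    (hq : ∀ n, q n ∈ P.domain) (hpa : Tendsto p atTop (𝓝 a)) (hqa : Tendsto q atTop (𝓝 a)) :
    NLP.ConvergesTo (fun n => S.approx (p n)) q P.toNLP a := by
  have had : a ∈ P.domain := ha.1
  have hp2 : Tendsto (fun n => (p n).2) atTop (𝓝 a.2) := (continuous_snd.tendsto a).comp hpa
  have hq2 : Tendsto (fun n => (q n).2) atTop (𝓝 a.2) := (continuous_snd.tendsto a).comp hqa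
  have hpi : ∀ i, Tendsto (fun n => ((p n).1 i, (p n).2)) atTop (𝓝 (a.1 i, a.2)) :=
    fun i => ((P.pair i).continuous.tendsto a).comp hpa
  have hqi : ∀ i, Tendsto (fun n => ((q n).1 i, (q n).2)) atTop (𝓝 (a.1 i, a.2)) :=
    fun i => ((P.pair i).continuous.tendsto a).comp hqa
  have hp1 : ∀ i, Tendsto (fun n => (p n).1 i) atTop (𝓝 (a.1 i)) :=
    fun i => (continuous_fst.tendsto _).comp (hpi i)
  have hq1 : ∀ i, Tendsto (fun n => (q n).1 i) atTop (𝓝 (a.1 i)) :=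
    fun i => (continuous_fst.tendsto _).comp (hqi i)
  have hai : ∀ i, (a.1 i, a.2) ∈ P.X i ×ˢ P.Y := fun i => ⟨had.1 i, had.2⟩
  have hpm : ∀ n i, ((p n).1 i, (p n).2) ∈ P.X i ×ˢ P.Y := fun n i => ⟨(hp n).1 i, (hp n).2⟩
  have hqm : ∀ n i, ((q n).1 i, (q n).2) ∈ P.X i ×ˢ P.Y := fun n i => ⟨(hq n).1 i, (hq n).2⟩
  refine ⟨fun _ => rfl, ha, hqa, ?_, fun j => ?_, ?_, fun l => ?_⟩
  · rw [← hS.fderiv_obj_eq hP had, hS.fderiv_obj hP had had]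
    simp only [fun n => hS.fderiv_obj hP (hp n) (hq n)]
    refine Tendsto.add (Tendsto.clm_comp_right ?_ _)
      (tendsto_finsetSum _ fun i _ => Tendsto.clm_comp_right ?_ _)
    · exact hS.F₀.grad_cont.tendsto_comp_of_mem (a := (a.2, a.2)) ⟨hP.Y_sub_V had.2, had.2⟩
        (hq2.prodMk_nhds hp2) fun n => ⟨hP.Y_sub_V (hq n).2, (hp n).2⟩
    · exact (hS.F i).grad_cont.tendsto_comp_of_mem (a := ((a.1 i, a.2), (a.1 i, a.2)))
        ⟨hP.prod_subset i (hai i), hai i⟩ ((hqi i).prodMk_nhds (hpi i))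
        fun n => ⟨hP.prod_subset i (hqm n i), hpm n i⟩
  · rw [← hS.ineq_self had j]
    rcases j with b | b | j
    · exact ((continuous_apply b.2).tendsto _).comp ((hS.Gt b.1).cont.tendsto_comp_of_mem
        (a := ((a.1 b.1, a.2), (a.1 b.1, a.2))) ⟨hai _, hai _⟩
        ((hqi b.1).prodMk_nhds (hpi b.1)) fun n => ⟨hqm n _, hpm n _⟩)
    · exact ((continuous_apply b.2).tendsto _).comp ((hS.G b.1).cont.tendsto_comp_of_mem
        (a := (a.1 b.1, a.1 b.1)) ⟨had.1 _, had.1 _⟩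
        ((hq1 b.1).prodMk_nhds (hp1 b.1)) fun n => ⟨(hq n).1 _, (hp n).1 _⟩)
    · exact ((continuous_apply j).tendsto _).comp (hS.G₀.cont.tendsto_comp_of_mem
        (a := (a.2, a.2)) ⟨had.2, had.2⟩ (hq2.prodMk_nhds hp2) fun n => ⟨(hq n).2, (hp n).2⟩)
  · rintro (b | b | j)
    · rw [toNLP_eq_blockNLP,
        (hasFDerivAt_blockNLP_ineq_inl b (hP.differentiableAt_gt had b.1)).fderiv,
        ← (hS.Gt b.1).grad_eq _ (hai _)]
      simp only [fun n => hS.fderiv_ineq_inl (hp n) (hq n) b]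
      refine Tendsto.clm_comp_right (Tendsto.clm_comp_left ?_ _) _
      exact (hS.Gt b.1).grad_cont.tendsto_comp_of_mem
        (a := ((a.1 b.1, a.2), (a.1 b.1, a.2))) ⟨hai _, hai _⟩
        ((hqi b.1).prodMk_nhds (hpi b.1)) fun n => ⟨hqm n _, hpm n _⟩
    · rw [toNLP_eq_blockNLP,
        (hasFDerivAt_blockNLP_ineq_inr_inl b (hP.differentiableAt_g had b.1)).fderiv,
        ← (hS.G b.1).grad_eq _ (had.1 _)]
      simp only [fun n => hS.fderiv_ineq_inr_inl (hp n) (hq n) b]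
      refine Tendsto.clm_comp_right (Tendsto.clm_comp_left ?_ _) _
      exact (hS.G b.1).grad_cont.tendsto_comp_of_mem
        (a := (a.1 b.1, a.1 b.1)) ⟨had.1 _, had.1 _⟩
        ((hq1 b.1).prodMk_nhds (hp1 b.1)) fun n => ⟨(hq n).1 _, (hp n).1 _⟩
    · rw [toNLP_eq_blockNLP,
        (hasFDerivAt_blockNLP_ineq_inr_inr j (hP.differentiableAt_g₀ had.2)).fderiv,
        ← hS.G₀.grad_eq _ had.2]
      simp only [fun n => hS.fderiv_ineq_inr_inr (hp n) (hq n) j]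
      refine Tendsto.clm_comp_right (Tendsto.clm_comp_left ?_ _) _
      exact hS.G₀.grad_cont.tendsto_comp_of_mem
        (a := (a.2, a.2)) ⟨had.2, had.2⟩ (hq2.prodMk_nhds hp2) fun n => ⟨(hq n).2, (hp n).2⟩
  · have hrw : ∀ n, fderiv ℝ ((S.approx (p n)).eqc l) (q n) = P.eqLin l := fun n =>
      (P.hasFDerivAt_eqFun l (q n)).fderiv
    have hrw' : fderiv ℝ (P.toNLP.eqc l) a = P.eqLin l := (P.hasFDerivAt_eqFun l a).fderiv
    simp only [hrw, hrw']
    exact tendsto_const_nhds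

/-- Convergence of the outer loop, for directions given by the optimal points of the approximate
problems: every cluster point is stationary. -/
theorem Surrogates.IsValid.isStationary_of_mapClusterPt (hS : S.IsValid) (hP : P.Assumptions)
    (hreg : P.toNLP.AllRegular) {p q : ℕ → P.Var} {step : ℕ → ℝ}
    (hp : ∀ k, p k ∈ P.toNLP.feasibleSet) (hq : ∀ k, (S.approx (p k)).IsOptimal (q k))
    (hstep : ∀ k, 0 < step k) (hlim : Tendsto step atTop (𝓝 0))
    (hsum : Tendsto (fun N => ∑ k ∈ Finset.range N, step k) atTop atTop)
    (hupd : ∀ k, p (k + 1) = p k + step k • (q k - p k)) {a : P.Var}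
    (ha : MapClusterPt a atTop p) : P.toNLP.IsStationary a := by
  obtain ⟨c, hc, hstrong⟩ := hS.exists_strong hP
  obtain ⟨K, hK, hdesc⟩ := hP.exists_descent
  have hbdd : BddBelow (range fun k => P.toNLP.obj (p k)) := by
    refine hP.bddBelow.mono ?_
    rintro _ ⟨k, rfl⟩
    exact ⟨_, hp k, rfl⟩
  -- Same summation of two strong convexity inequalities, now at `p k` and `q k`; at `p k` the
  -- approximate gradient is the true one.
  have hdir : ∀ k, fderiv ℝ P.toNLP.obj (p k) (q k - p k) ≤ -(2 * c) * ‖q k - p k‖ ^ 2 := by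
    intro k
    have h1 := hstrong (p k) (hp k).1 (q k) (hq k).1.1 (p k) (hp k).1
    have h2 := hstrong (p k) (hp k).1 (p k) (hp k).1 (q k) (hq k).1.1
    have h3 := hS.fderiv_nonneg_of_isOptimal hP (hp k).1 (hq k) _
      (hS.self_mem_feasibleSet (hp k))
    rw [hS.fderiv_obj_eq hP (hp k).1] at h1
    rw [norm_sub_rev (p k)] at h2
    linarith
  -- Of the first-order gain `2c`, the quadratic error `K * step k < c` consumes less than half once
  -- the step is small.
  have hdec : ∀ᶠ k in atTop, P.toNLP.obj (p (k + 1)) ≤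
      P.toNLP.obj (p k) - c * step k * ‖q k - p k‖ ^ 2 := by
    have hsmall : ∀ᶠ k in atTop, K * step k < c := by
      have : Tendsto (fun k => K * step k) atTop (𝓝 0) := by simpa using hlim.const_mul K
      exact this.eventually_lt_const hc
    filter_upwards [hsmall] with k hk
    have h := hdesc (p (k + 1)) (hp (k + 1)).1 (p k) (hp k).1
    have hd : p (k + 1) - p k = step k • (q k - p k) := by rw [hupd, add_sub_cancel_left]
    rw [hd, map_smul, norm_smul, Real.norm_of_nonneg (hstep k).le, smul_eq_mul, mul_pow] at h
    have h1 := mul_le_mul_of_nonneg_left (hdir k) (hstep k).le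
    have h2 := mul_le_mul_of_nonneg_right hk.le
      (mul_nonneg (hstep k).le (sq_nonneg ‖q k - p k‖))
    linarith
  have hfreq : ∀ n : ℕ, ∃ᶠ k in atTop, dist (p k) a < 1 / ((n : ℝ) + 1) ∧
      ‖q k - p k‖ < 1 / ((n : ℝ) + 1) := fun n =>
    frequently_small_of_mapClusterPt hc (fun k => norm_nonneg (q k - p k)) hstep hsum hbdd hdec
      (fun k => by
        rw [hupd, dist_eq_norm, add_sub_cancel_left, norm_smul,
          Real.norm_of_nonneg (hstep k).le])
      ha Nat.one_div_pos_of_nat Nat.one_div_pos_of_nat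
  -- The indices need not increase: closeness to `a` and short directions are all that the limit
  -- uses.
  choose φ hφ using fun n => (hfreq n).exists
  have hpa : Tendsto (fun n => p (φ n)) atTop (𝓝 a) := by
    rw [tendsto_iff_dist_tendsto_zero]
    exact squeeze_zero (fun _ => dist_nonneg) (fun n => (hφ n).1.le)
      tendsto_one_div_add_atTop_nhds_zero_nat
  have hdiff : Tendsto (fun n => q (φ n) - p (φ n)) atTop (𝓝 0) :=
    squeeze_zero_norm (fun n => (hφ n).2.le) tendsto_one_div_add_atTop_nhds_zero_nat
  have hqa : Tendsto (fun n => q (φ n)) atTop (𝓝 a) := by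
    simpa using hpa.add hdiff
  have haf : a ∈ P.toNLP.feasibleSet :=
    hP.isClosed_feasibleSet.mem_of_tendsto hpa (Eventually.of_forall fun n => hp (φ n))
  exact (hS.convergesTo hP haf (fun n => (hp (φ n)).1) (fun n => (hq (φ n)).1.1) hpa
    hqa).isStationary (hreg a haf) fun n => hS.exists_isFritzJohn hP (hp (φ n)).1 (hq (φ n))

end SPDProblem

theorem mainTheorem7 (P : SPDProblem) (S : P.Surrogates)
    (hP : P.Assumptions)
    (hreg : P.toNLP.AllRegular)
    (hS : S.IsValid)
    (hF : S.ObjectiveSeparable)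
    (hG : S.ConstraintSeparable)
    (p : ℕ → P.Var) (step : ℕ → ℝ) (T : ℕ → P.InnerTrace)
    (hrun : P.IsSPDARun S p step T)
    (hregSub : ∀ k i, ∀ y ∈ S.masterSet (p k) ∩ S.masterDom (p k),
      (S.sub (p k) i y).AllRegular)
    (hslater : ∀ k i, ∀ y ∈ S.masterSet (p k) ∩ S.masterDom (p k),
      (S.sub (p k) i y).Slater)
    (hbdd : ∀ k, Bornology.IsBounded (Set.range (T k).primal)) :
    (∀ k, ∃ q, (S.approx (p k)).IsUniqueOptimal q ∧
      Tendsto (T k).primal atTop (𝓝 q)) ∧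
    ((∃ a, MapClusterPt a atTop p) →
      ∃ a, MapClusterPt a atTop p ∧ P.toNLP.IsStationary a) := by
  have hinner : ∀ k, p k ∈ P.toNLP.feasibleSet →
      ∃ q, (S.approx (p k)).IsUniqueOptimal q ∧ Tendsto (T k).primal atTop (𝓝 q) :=
    fun k hk => (hrun.inner_run k).tendsto_isUniqueOptimal hP hS hF hG hk (hregSub k) (hbdd k)
  -- Feasibility and inner convergence are intertwined: `update` is informative only once the inner
  -- limit exists, and that is proved at feasible base points.
  have hfeas : ∀ k, p k ∈ P.toNLP.feasibleSet := by
    intro k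
    induction k with
    | zero => exact hrun.init
    | succ k ih =>
      obtain ⟨q, hq, hlim⟩ := hinner k ih
      rw [hrun.update k q hlim]
      exact hS.feasibleSet_subset ih.1 ((hS.convex_feasibleSet hP ih.1).add_smul_sub_mem
        (hS.self_mem_feasibleSet ih) hq.1.1 ⟨(hrun.step_pos k).le, hrun.step_le k⟩)
  refine ⟨fun k => hinner k (hfeas k), ?_⟩
  rintro ⟨a, ha⟩
  choose q hq hlim using fun k => hinner k (hfeas k)
  exact ⟨a, ha, hS.isStationary_of_mapClusterPt hP hreg hfeas (fun k => (hq k).1) hrun.step_pos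
    hrun.step_lim hrun.step_sum (fun k => hrun.update k (q k) (hlim k)) ha⟩
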